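/- Let $E/\mathbb{Q}$ be an elliptic curve given by a global minimal Weierstrass equation with discriminant $\Delta_E$. Assume that $E$ is semistable, that $\mathrm{ord}_2(\Delta_E)$ is odd, that $3$ is a prime of good reduction for $E$, and that $3 \nmid \mathrm{ord}_\ell(\Delta_E)$ for every prime $\ell$ of bad reduction for $E$. Let $d$ be a squarefree integer (of either sign) with $d \equiv 1 \pmod 4$ and $\gcd(d, \Delta_E) = 1$ such that for every prime $\ell$ of bad (hence multiplicative) reduction for $E$: - if $E$ has split multiplicative reduction at $\ell$, then $d \not\equiv 1 \pmod 8$ if $\ell = 2$; $d$ is not a square modulo $\ell$ if $\ell \neq 2$ and $\ell \equiv 1 \pmod 3$; and $d$ is a square modulo $\ell$ if $\ell \ne 2$ and $\ell \equiv 2 \pmod 3$; - if $E$ has nonsplit multiplicative reduction at $\ell$, then $d \equiv 1 \pmod 8$ if $\ell = 2$; $d$ is a square modulo $\ell$ if $\ell \neq 2$ and $\ell \equiv 1 \pmod 3$; and $d$ is not a square modulo $\ell$ if $\ell \neq 2$ and $\ell \equiv 2 \pmod 3$. Let $E^{(d)}/\mathbb{Q}$ be the quadratic twist of $E$ by $d$,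 let $\mathrm{Sel}_3(E^{(d)}/\mathbb{Q}) \subset H^1(\mathbb{Q}, E^{(d)}[3])$ be its $3$-Selmer group, that is, the kernel of $H^1(\mathbb{Q}, E^{(d)}[3]) \to \prod_v H^1(\mathbb{Q}_v, E^{(d)})$, the product being over all places $v$ of $\mathbb{Q}$, and let $H^1(\mathbb{Q}, E^{(d)}[3]; \{3\})$ be the subgroup of the classes that are unramified at every place of $\mathbb{Q}$ other than $3$, i.e. whose restriction to the inertia group at each such place is trivial (the inertia group at the archimedean place being $\mathrm{Gal}(\mathbb{C}/\mathbb{R})$). Then $$\mathrm{Sel}_3(E^{(d)}/\mathbb{Q}) \subset H^1(\mathbb{Q}, E^{(d)}[3]; \{3\}).$$ -/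

import Mathlib

section ContinuousCohomology

/-! ### Continuous cohomology in degree one of a topological group with discrete coefficients -/

section

variable (G M : Type*) [Group G] [TopologicalSpace G] [AddCommGroup M] [DistribMulAction G M]

/-- Continuous `1`-cocycles `f : G → M`, where `M` is discrete: crossed homomorphisms that are
locally constant. -/
def contZ1 : AddSubgroup (G → M) where
  carrier := {f | IsLocallyConstant f ∧ ∀ g h, f (g * h) = f g + g • f h}
  zero_mem' := ⟨IsLocallyConstant.const 0, by simp⟩
  add_mem' := by
    rintro a b ⟨ha, ha'⟩ ⟨hb, hb'⟩
    refine ⟨ha.add hb, fun g h => ?_⟩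
    simp only [Pi.add_apply, ha', hb', smul_add]
    abel
  neg_mem' := by
    rintro a ⟨ha, ha'⟩
    refine ⟨ha.neg, fun g h => ?_⟩
    simp only [Pi.neg_apply, ha', smul_neg]
    abel

/-- Those continuous `1`-cocycles that are coboundaries `g ↦ g • m - m`. -/
def contB1 : AddSubgroup (contZ1 G M) where
  carrier := {f | ∃ m : M, ∀ g, f.1 g = g • m - m}
  zero_mem' := ⟨0, by simp⟩
  add_mem' := by
    rintro a b ⟨m, hm⟩ ⟨n, hn⟩
    refine ⟨m + n, fun g => ?_⟩
    simp only [AddSubgroup.coe_add, Pi.add_apply, hm, hn, smul_add]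
    abel
  neg_mem' := by
    rintro a ⟨m, hm⟩
    refine ⟨-m, fun g => ?_⟩
    simp only [AddSubgroup.coe_neg, Pi.neg_apply, hm, smul_neg]
    abel

/-- The continuous cohomology group `H¹(G, M)` of the discrete `G`-module `M`. -/
def contH1 : Type _ := contZ1 G M ⧸ contB1 G M

instance contH1AddCommGroup : AddCommGroup (contH1 G M) :=
  inferInstanceAs (AddCommGroup (contZ1 G M ⧸ contB1 G M))

/-- The class of a cocycle. -/
def contH1Mk : contZ1 G M →+ contH1 G M := QuotientAddGroup.mk' (contB1 G M)

end

variable {G M H N : Type*} [Group G] [TopologicalSpace G] [AddCommGroup M] [DistribMulAction G M]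
  [Group H] [TopologicalSpace H] [AddCommGroup N] [DistribMulAction H N]

/-- The map on cocycles `f ↦ ψ ∘ f ∘ φ` for a continuous homomorphism `φ : H → G` and a compatible
homomorphism of modules `ψ : M → N`. -/
def contZ1Map (φ : H →* G) (hφ : Continuous φ) (ψ : M →+ N)
    (hψ : ∀ h m, ψ (φ h • m) = h • ψ m) : contZ1 G M →+ contZ1 H N where
  toFun f := ⟨fun h => ψ (f.1 (φ h)), (f.2.1.comp_continuous hφ).comp ψ, fun g h => by
    simp only [map_mul, f.2.2, map_add, hψ]⟩
  map_zero' := by ext; simp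
  map_add' a b := by ext; simp

/-- The map `H¹(G, M) → H¹(H, N)` induced by a continuous homomorphism `φ : H → G` and a compatible
homomorphism of modules `ψ : M → N`. -/
def contH1Map (φ : H →* G) (hφ : Continuous φ) (ψ : M →+ N)
    (hψ : ∀ h m, ψ (φ h • m) = h • ψ m) : contH1 G M →+ contH1 H N :=
  QuotientAddGroup.map _ _ (contZ1Map φ hφ ψ hψ) (by
    rintro f ⟨m, hm⟩
    refine ⟨ψ m, fun h => ?_⟩
    change ψ (f.1 (φ h)) = _
    rw [hm, map_sub, hψ])

/-- Restriction `H¹(G, M) → H¹(I, M)` to a subgroup `I` of `G`. -/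
def contH1Res (I : Subgroup G) : contH1 G M →+ contH1 I M :=
  contH1Map I.subtype continuous_subtype_val (AddMonoidHom.id M) (fun _ _ => rfl)

end ContinuousCohomology

section GaloisAction

/-! ### Galois action on points, torsion, and restriction to local Galois groups -/

open scoped WeierstrassCurve.Affine Classical

variable {K L F : Type*} [Field K] [Field L] [Field F] [Algebra K L] [Algebra L F] [Algebra K F]
  [IsScalarTower K L F]

/-- For a Weierstrass curve `W` over `K` and extensions `F / L / K`, the group `Gal(F/L)` acts on
`W(F)` through the coordinates. -/
noncomputable instance galPointAction (W : WeierstrassCurve K) :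
    DistribMulAction (F ≃ₐ[L] F) (W.baseChange F).toAffine.Point where
  smul σ P := WeierstrassCurve.Affine.Point.map (W' := W.toAffine) (σ : F →ₐ[L] F) P
  one_smul P := by cases P <;> rfl
  mul_smul σ τ P := by cases P <;> rfl
  smul_zero σ := map_zero (WeierstrassCurve.Affine.Point.map (W' := W.toAffine) (σ : F →ₐ[L] F))
  smul_add σ := map_add (WeierstrassCurve.Affine.Point.map (W' := W.toAffine) (σ : F →ₐ[L] F))

/-- The `n`-torsion subgroup of a group with an action of `G` is stable under `G`. -/
noncomputable instance torsionAction {G A : Type*} [Group G] [AddCommGroup A]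
    [DistribMulAction G A] (n : ℕ) : DistribMulAction G (AddSubgroup.torsionBy A n) where
  smul σ P := ⟨σ • P.1, by
    have h := AddSubgroup.torsionBy.nsmul_iff.mp P.2
    rw [AddSubgroup.torsionBy.nsmul_iff, smul_comm, h, smul_zero]⟩
  one_smul P := Subtype.ext (one_smul G P.1)
  mul_smul σ τ P := Subtype.ext (mul_smul σ τ P.1)
  smul_zero σ := Subtype.ext (smul_zero σ)
  smul_add σ P Q := Subtype.ext (smul_add σ P.1 Q.1)

variable {Kbar : Type*} [Field Kbar] [Algebra K Kbar] [Normal K Kbar]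

/-- For a `K`-embedding `ι : Kbar → F` of a normal extension `Kbar / K`, the restriction homomorphism
`Gal(F/L) → Gal(Kbar/K)`; see `galoisRestriction_spec`. -/
noncomputable def galoisRestriction (L : Type*) [Field L] [Algebra K L] [Algebra L F]
    [IsScalarTower K L F] (ι : Kbar →ₐ[K] F) : (F ≃ₐ[L] F) →* (Kbar ≃ₐ[K] Kbar) :=
  letI : Algebra Kbar F := ι.toRingHom.toAlgebra
  haveI : IsScalarTower K Kbar F := IsScalarTower.of_algebraMap_eq fun x => (ι.commutes x).symm
  (AlgEquiv.restrictNormalHom Kbar).comp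
    { toFun := fun σ : F ≃ₐ[L] F => σ.restrictScalars K
      map_one' := rfl
      map_mul' := fun _ _ => rfl }

theorem galoisRestriction_spec (ι : Kbar →ₐ[K] F) (σ : F ≃ₐ[L] F) (x : Kbar) :
    ι (galoisRestriction L ι σ x) = σ (ι x) := by
  let : Algebra Kbar F := ι.toRingHom.toAlgebra
  have : IsScalarTower K Kbar F := IsScalarTower.of_algebraMap_eq fun x => (ι.commutes x).symm
  exact AlgEquiv.restrictNormal_commutes (σ.restrictScalars K) Kbar x

theorem continuous_galoisRestriction (ι : Kbar →ₐ[K] F) : Continuous (galoisRestriction L ι) := by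
  refine continuous_of_continuousAt_one _ ?_
  rw [ContinuousAt, map_one]
  intro U hU
  obtain ⟨M, hM, hMU⟩ := (krullTopology_mem_nhds_one_iff K Kbar U).mp hU
  obtain ⟨S, hS⟩ : M.FG := IntermediateField.essFiniteType_iff.mp inferInstance
  let T : IntermediateField L F := IntermediateField.adjoin L (ι '' S)
  have : FiniteDimensional L T := IntermediateField.finiteDimensional_adjoin (by
    rintro _ ⟨x, -, rfl⟩
    exact ((Normal.isIntegral (F := K) inferInstance x).map ι).tower_top)
  refine (krullTopology_mem_nhds_one_iff L F _).mpr ⟨T, this, fun σ hσ => hMU ?_⟩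
  rw [← hS]
  have : ∀ x ∈ S, galoisRestriction L ι σ x = x := fun x hx => ι.injective (by
    refine (galoisRestriction_spec ι σ x).trans ?_
    exact hσ ⟨ι x, IntermediateField.subset_adjoin L _ ⟨x, hx, rfl⟩⟩)
  change _ ∈ IntermediateField.fixingSubgroup _
  rw [← Subgroup.zpowers_le, ← IntermediateField.le_iff_le, IntermediateField.adjoin_le_iff]
  intro x hx
  rintro ⟨_, k, rfl⟩
  exact (Subgroup.zpowers_le.mpr (show galoisRestriction L ι σ ∈ MulAction.stabilizer _ x from this x hx))
    ⟨k, rfl⟩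

/-- For a Weierstrass curve `W` over `K` and a `K`-embedding `ι : Kbar → F`, the localization map
`H¹(K, W[n]) → H¹(L, W)`, i.e. `H¹(Gal(Kbar/K), W(Kbar)[n]) → H¹(Gal(F/L), W(F))`. -/
noncomputable def torsionLocalization (W : WeierstrassCurve K) (n : ℕ)
    (L : Type*) [Field L] [Algebra K L] [Algebra L F] [IsScalarTower K L F] (ι : Kbar →ₐ[K] F) :
    contH1 (Kbar ≃ₐ[K] Kbar)
        (AddSubgroup.torsionBy (W.baseChange Kbar).toAffine.Point (n : ℤ)) →+
      contH1 (F ≃ₐ[L] F) (W.baseChange F).toAffine.Point :=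
  contH1Map (galoisRestriction L ι) (continuous_galoisRestriction ι)
    ((WeierstrassCurve.Affine.Point.map (W' := W.toAffine) ι).comp (AddSubgroup.subtype _)) (by
      rintro σ ⟨P, hP⟩
      rcases P with _ | ⟨x, y, h⟩
      · rfl
      · change WeierstrassCurve.Affine.Point.some _ _ _ = WeierstrassCurve.Affine.Point.some _ _ _
        congr 1 <;> exact galoisRestriction_spec ι σ _)

end GaloisAction

section RationalPlaces

/-! ### Places of `ℚ`, unramified classes and Selmer groups -/

open scoped WeierstrassCurve.Affine Classical

/-- The absolute Galois group of `ℚ`, with its Krull topology. -/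
abbrev GalQ : Type := AlgebraicClosure ℚ ≃ₐ[ℚ] AlgebraicClosure ℚ

instance normal_algebraicClosure_rat : Normal ℚ (AlgebraicClosure ℚ) := by
  have : Algebra.IsAlgebraic ℚ (AlgebraicClosure ℚ) := by
    convert! AlgebraicClosure.isAlgebraic ℚ
  exact normal_iff.mpr fun x =>
    ⟨(Algebra.IsAlgebraic.isAlgebraic x).isIntegral, IsAlgClosed.splits _⟩

/-- The places of `ℚ`: the archimedean one, and one for each prime number. -/
inductive PlaceQ : Type
  | infinite : PlaceQ
  | finite (p : ℕ) (hp : p.Prime) : PlaceQ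

/-- The inertia subgroup of the Galois group of `PadicAlgCl p` over `ℚ_[p]`: the automorphisms that
act trivially on the residue field of `PadicAlgCl p` (whose norm is the unique extension of the
`p`-adic absolute value). -/
noncomputable def padicInertia (p : ℕ) [Fact p.Prime] :
    Subgroup (PadicAlgCl p ≃ₐ[ℚ_[p]] PadicAlgCl p) where
  carrier := {σ | ∀ x : PadicAlgCl p, ‖x‖ ≤ 1 → ‖σ x - x‖ < 1}
  one_mem' := by simp
  mul_mem' := by
    intro σ τ hσ hτ x hx
    have h : ‖τ x‖ = ‖x‖ := (spectralNorm_eq_of_equiv (K := ℚ_[p]) τ x).symm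
    have := IsUltrametricDist.norm_add_le_max (σ (τ x) - τ x) (τ x - x)
    rw [sub_add_sub_cancel] at this
    exact this.trans_lt (max_lt (hσ _ (h.trans_le hx)) (hτ x hx))
  inv_mem' := by
    intro σ hσ x hx
    have h : ‖σ⁻¹ x‖ = ‖x‖ := (spectralNorm_eq_of_equiv (K := ℚ_[p]) σ⁻¹ x).symm
    have := hσ (σ⁻¹ x) (h.trans_le hx)
    rwa [← AlgEquiv.mul_apply, mul_inv_cancel, AlgEquiv.one_apply, norm_sub_rev] at this

/-- The inertia subgroups of `GalQ` at a place `v`, one for each embedding of the algebraic closure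
of `ℚ` into that of `ℚ_v` (they are all conjugate). At the archimedean place the inertia group is
the whole decomposition group `Gal(ℂ/ℝ)`. -/
noncomputable def inertiaSubgroups : PlaceQ → Set (Subgroup GalQ)
  | .infinite => {I | ∃ ι : AlgebraicClosure ℚ →ₐ[ℚ] ℂ, I = (galoisRestriction ℝ ι).range}
  | .finite p hp => haveI := Fact.mk hp
    {I | ∃ ι : AlgebraicClosure ℚ →ₐ[ℚ] PadicAlgCl p,
      I = (padicInertia p).map (galoisRestriction ℚ_[p] ι)}

/-- `H¹(ℚ, M; Σ)`: the classes in `H¹(ℚ, M)` that are unramified at all places outside `Σ`, i.e.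
whose restriction to the inertia subgroups at these places is trivial. -/
noncomputable def unramifiedOutside (M : Type*) [AddCommGroup M] [DistribMulAction GalQ M] (S : Set PlaceQ) :
    AddSubgroup (contH1 GalQ M) :=
  ⨅ v ∈ Sᶜ, ⨅ I ∈ inertiaSubgroups v, (contH1Res I).ker

/-- The Galois module `W[n]` of `n`-torsion points over the algebraic closure of `ℚ`. -/
abbrev torsionModule (W : WeierstrassCurve ℚ) (n : ℕ) : Type :=
  AddSubgroup.torsionBy (W.baseChange (AlgebraicClosure ℚ)).toAffine.Point (n : ℤ)

/-- Classes of `H¹(ℚ, W[n])` that become trivial in `H¹(ℚ_v, W)`. -/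
noncomputable def selmerCondition (W : WeierstrassCurve ℚ) (n : ℕ) :
    PlaceQ → AddSubgroup (contH1 GalQ (torsionModule W n))
  | .infinite => ⨅ ι : AlgebraicClosure ℚ →ₐ[ℚ] ℂ, (torsionLocalization W n ℝ ι).ker
  | .finite p hp => haveI := Fact.mk hp
    ⨅ ι : AlgebraicClosure ℚ →ₐ[ℚ] PadicAlgCl p, (torsionLocalization W n ℚ_[p] ι).ker

/-- The `n`-Selmer group of `W` over `ℚ`: the kernel of `H¹(ℚ, W[n]) → ∏_v H¹(ℚ_v, W)`, over all
places `v` of `ℚ`. -/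
noncomputable def selmerGroup (W : WeierstrassCurve ℚ) (n : ℕ) :
    AddSubgroup (contH1 GalQ (torsionModule W n)) :=
  ⨅ v, selmerCondition W n v

end RationalPlaces

section Curves

/-! ### Quadratic twists and reduction types -/

namespace WeierstrassCurve

/-- The quadratic twist by `d`: with `y' = y + (a₁ x + a₃) / 2`, the curve `W` reads
`y' ^ 2 = x ^ 3 + (b₂ / 4) x ^ 2 + (b₄ / 2) x + b₆ / 4`; its twist is
`d y' ^ 2 = x ^ 3 + (b₂ / 4) x ^ 2 + (b₄ / 2) x + b₆ / 4`, made monic by the substitution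
`(x, y') ↦ (x / d, y' / d ^ 2)`. -/
def quadTwist {K : Type*} [Field K] (W : WeierstrassCurve K) (d : K) : WeierstrassCurve K where
  a₁ := 0
  a₂ := d * W.b₂ / 4
  a₃ := 0
  a₄ := d ^ 2 * W.b₄ / 2
  a₆ := d ^ 3 * W.b₆ / 4

variable (E : WeierstrassCurve ℤ) (p : ℕ) [Fact p.Prime]

/-- `E` is a minimal Weierstrass equation at `p`. -/
def MinimalAt : Prop := IsMinimal ℤ_[p] (E.baseChange ℚ_[p])

/-- The (minimal) equation `E` has good reduction at `p`. -/
def GoodAt : Prop := HasGoodReduction ℤ_[p] (E.baseChange ℚ_[p])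

/-- The (minimal) equation `E` has multiplicative reduction at `p`. -/
def MultiplicativeAt : Prop := HasMultiplicativeReduction ℤ_[p] (E.baseChange ℚ_[p])

/-- The (minimal) equation `E` has split multiplicative reduction at `p`. -/
def SplitAt : Prop := HasSplitMultiplicativeReduction ℤ_[p] (E.baseChange ℚ_[p])

/-- The (minimal) equation `E` has nonsplit multiplicative reduction at `p`. -/
def NonsplitAt : Prop := E.MultiplicativeAt p ∧ ¬ E.SplitAt p

end WeierstrassCurve

end Curves

/-!
Let `W` be the twist of `E` by `d` and `f` a cocycle of a Selmer class. At a prime `p ≠ 3` there is a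
point `P` of `W` over the algebraic closure of `ℚ_[p]` with `f σ = σ P - P` on the decomposition
group, and the task is to replace `P` by a `3`-torsion point on the inertia group. Throughout, the
points of `W` are seen through the coordinates `ξ = x / d` and `η` of `E` (`twistX`), which are defined
over the field generated by a square root `e` of `d`.

The basic tool is that reduction modulo `p` is injective on `3`-torsion. In the form needed here
(`eq_of_reduction_eq`): two points with the same nonsingular reduction whose difference is killed by
`3` are equal. If `σ` is in the inertia group and fixes `e`, this applies to `P` and `σ P`
(`eq_of_mem_padicInertia`), whenever `P` has nonsingular reduction on `E`.

* If `p ∤ Δ`, every point has nonsingular reduction, so `f` vanishes on the elements of the inertia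
  group that fix `e`. They form a subgroup of index at most `2`, and since `2` is invertible on the
  `3`-torsion, `f` is a coboundary on the inertia group (`exists_coboundary_of_index_two`). This
  covers the primes that divide `d`, and the same lemma settles the archimedean place.

* If `p ∣ Δ`, the reduction is multiplicative and `p ∤ d`, so that inertia fixes `e`
  (`padicInertia_apply_sqrt`; at `p = 2` this uses `d ≡ 1` modulo `4`). After the translation
  `X = ξ - r` by a solution `r` of `6 r ^ 2 + b₂ r + b₄ = 0`, found with Hensel's lemma
  (`exists_node`), the curve is `(2 y) ^ 2 = 4 X ^ 3 + s X ^ 2 + 4 β` with `s` a unit and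
  `ord β = ord Δ`. In place of Tate's uniformization, the addition formulas for the `x`-coordinate,
  encoded in `NodalCoordinate`, show that the absolute value of `X` determines the component of a
  point up to sign. The point `3 P` is rational over `ℚ_[p]`, because `3 (σ P - P) = 0` for all `σ`.
  So the multiples of `3 P` lie on finitely many components, and one of them has nonsingular
  reduction. If the order of the component of `3 P` were divisible by `3`, then some multiple would
  satisfy `|X| ^ 3 = |β|` with `|X|` an integral power of `p`, against `3 ∤ ord Δ`
  (`exists_nsmul_isNonsing`). Therefore `3 m P` has nonsingular reduction for some `m` prime to `3`.
  The point `m P` is then on a component of order dividing `3`, on which there is also a `3`-torsion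
  point (`exists_three_torsion`), so that `m P + T` has nonsingular reduction for a `3`-torsion
  point `T`. This sum is fixed by inertia, and since `m ^ 2 ≡ 1` modulo `3`, the cocycle of `P` is
  that of `-m T` (`sub_eq_of_nsmul_add_eq`).

The `3`-torsion points found over the algebraic closure of `ℚ_[p]` are algebraic over `ℚ`
(`exists_map_eq_of_three_nsmul_eq_zero`), hence belong to the global Galois module.
-/

section Ultrametric

/-! ### Ultrametric estimates -/

variable {K : Type*} [NormedField K]

theorem norm_mul_le_left {a b : K} {c : ℝ} (ha : ‖a‖ ≤ 1) (hb : ‖b‖ ≤ c) : ‖a * b‖ ≤ c := by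
  rw [norm_mul]
  exact (mul_le_of_le_one_left (norm_nonneg _) ha).trans hb

theorem norm_mul_lt_left {a b : K} {c : ℝ} (ha : ‖a‖ ≤ 1) (hb : ‖b‖ < c) : ‖a * b‖ < c := by
  rw [norm_mul]
  exact (mul_le_of_le_one_left (norm_nonneg _) ha).trans_lt hb

theorem norm_pow_le_one {a : K} (ha : ‖a‖ ≤ 1) (n : ℕ) : ‖a ^ n‖ ≤ 1 := by
  rw [norm_pow]; exact pow_le_one₀ (norm_nonneg _) ha

theorem norm_ofNat_le_one [IsUltrametricDist K] (n : ℕ) [n.AtLeastTwo] : ‖(ofNat(n) : K)‖ ≤ 1 := by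
  rw [← Nat.cast_ofNat]
  exact IsUltrametricDist.norm_natCast_le_one K _

variable {M : Type*} [SeminormedAddCommGroup M] [IsUltrametricDist M]

theorem nonarch_add_le {a b : M} {c : ℝ} (ha : ‖a‖ ≤ c) (hb : ‖b‖ ≤ c) : ‖a + b‖ ≤ c :=
  (IsUltrametricDist.norm_add_le_max a b).trans (max_le ha hb)

theorem nonarch_add_lt {a b : M} {c : ℝ} (ha : ‖a‖ < c) (hb : ‖b‖ < c) : ‖a + b‖ < c :=
  (IsUltrametricDist.norm_add_le_max a b).trans_lt (max_lt ha hb)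

theorem nonarch_sub_le {a b : M} {c : ℝ} (ha : ‖a‖ ≤ c) (hb : ‖b‖ ≤ c) : ‖a - b‖ ≤ c := by
  rw [sub_eq_add_neg]
  exact nonarch_add_le ha (by rwa [norm_neg])

theorem nonarch_sub_lt {a b : M} {c : ℝ} (ha : ‖a‖ < c) (hb : ‖b‖ < c) : ‖a - b‖ < c := by
  rw [sub_eq_add_neg]
  exact nonarch_add_lt ha (by rwa [norm_neg])

theorem nonarch_add_eq {a b : M} (h : ‖b‖ < ‖a‖) : ‖a + b‖ = ‖a‖ := by
  rw [IsUltrametricDist.norm_add_eq_max_of_norm_ne_norm h.ne', max_eq_left h.le]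

end Ultrametric

/-! ### Components of the points near a node -/

/-- The properties of the `x`-coordinate `X : G → K` on the group `G` of points of the curve
`(2 y) ^ 2 = 4 X ^ 3 + s X ^ 2 + 4 β` that are used below, over an ultrametric field in which `s` is
a unit and `β` is not: the reduction of the curve has a node at `X = 0`. The value of `X` at the
point at infinity plays no role. -/
structure NodalCoordinate {K : Type*} [NormedField K] {G : Type*} [AddCommGroup G]
    (X : G → K) (s β : K) : Prop where
  norm_s : ‖s‖ = 1
  norm_β : ‖β‖ < 1
  map_neg : ∀ P, X (-P) = X P
  eq_or_eq_neg : ∀ {P Q}, P ≠ 0 → Q ≠ 0 → X P = X Q → P = Q ∨ P = -Q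
  add_root : ∀ {P Q}, P ≠ 0 → Q ≠ 0 → P + Q ≠ 0 →
    (X P - X Q) ^ 2 * X (P + Q) ^ 2 - (X P * X Q * (2 * (X P + X Q) + s) + 4 * β) * X (P + Q) +
      (X P ^ 2 * X Q ^ 2 - 4 * β * (X P + X Q) - s * β) = 0
  add_add_sub : ∀ {P Q}, P ≠ 0 → Q ≠ 0 → P + Q ≠ 0 → P - Q ≠ 0 →
    (X P - X Q) ^ 2 * (X (P + Q) + X (P - Q)) = X P * X Q * (2 * (X P + X Q) + s) + 4 * β

namespace NodalCoordinate

variable {K : Type*} [NormedField K] {G : Type*} [AddCommGroup G] {X : G → K} {s β : K}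

/-- The points of nonsingular reduction. -/
def IsNonsing (X : G → K) (P : G) : Prop := P = 0 ∨ 1 ≤ ‖X P‖

theorem not_isNonsing {P : G} : ¬ IsNonsing X P ↔ P ≠ 0 ∧ ‖X P‖ < 1 := by
  simp [IsNonsing]

theorem isNonsing_neg (h : NodalCoordinate X s β) {P : G} (hP : IsNonsing X P) : IsNonsing X (-P) := by
  simpa [IsNonsing, h.map_neg] using hP

variable [IsUltrametricDist K] (h : NodalCoordinate X s β)

include h

/-- With `isNonsing_sub`: the points of nonsingular reduction are a subgroup. -/
theorem isNonsing_add {P Q : G} (hP : IsNonsing X P) (hQ : IsNonsing X Q) :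
    IsNonsing X (P + Q) := by
  by_cases P0 : P = 0
  · simpa [P0] using hQ
  by_cases Q0 : Q = 0
  · simpa [Q0] using hP
  by_contra hPQ
  obtain ⟨PQ0, ht⟩ := not_isNonsing.mp hPQ
  have hx : 1 ≤ ‖X P‖ := hP.resolve_left P0
  have hy : 1 ≤ ‖X Q‖ := hQ.resolve_left Q0
  have x0 : X P ≠ 0 := norm_pos_iff.mp (by linarith)
  have y0 : X Q ≠ 0 := norm_pos_iff.mp (by linarith)
  have key := h.add_root P0 Q0 PQ0
  generalize X (P + Q) = t at *
  obtain ⟨u, hu⟩ : ∃ u, u = (X P)⁻¹ := ⟨_, rfl⟩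
  obtain ⟨v, hv⟩ : ∃ v, v = (X Q)⁻¹ := ⟨_, rfl⟩
  have hu1 : ‖u‖ ≤ 1 := by rw [hu, norm_inv]; exact inv_le_one_of_one_le₀ hx
  have hv1 : ‖v‖ ≤ 1 := by rw [hv, norm_inv]; exact inv_le_one_of_one_le₀ hy
  -- the equation of `t`, divided by `X P ^ 2 * X Q ^ 2`, has constant term `1` modulo `β`
  have key2 : (1 : K) = ((2 * (u + v) + s * (u * v) + 4 * (β * (u ^ 2 * v ^ 2)))
      - (v - u) ^ 2 * t) * t + (4 * (u * v ^ 2 + u ^ 2 * v) + s * (u ^ 2 * v ^ 2)) * β := by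
    have : X P = u⁻¹ := by simp [hu]
    rw [this] at key x0
    have : X Q = v⁻¹ := by simp [hv]
    rw [this] at key y0
    have u0 : u ≠ 0 := by simpa using x0
    have v0 : v ≠ 0 := by simpa using y0
    field_simp at key
    linear_combination key
  have hs := h.norm_s.le
  have hβ := h.norm_β
  have huv : ‖u * v‖ ≤ 1 := norm_mul_le_left hu1 hv1
  have huv2 : ‖u ^ 2 * v ^ 2‖ ≤ 1 := by
    rw [← mul_pow, norm_pow]; exact pow_le_one₀ (norm_nonneg _) huv
  have h4 := norm_ofNat_le_one (K := K) 4
  have h2 := norm_ofNat_le_one (K := K) 2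
  have : ‖(1 : K)‖ < 1 := by
    rw [key2]
    refine nonarch_add_lt (norm_mul_lt_left ?_ ht) (norm_mul_lt_left ?_ hβ)
    · refine nonarch_sub_le (nonarch_add_le (nonarch_add_le ?_ ?_) ?_) ?_
      · exact norm_mul_le_left h2 (nonarch_add_le hu1 hv1)
      · exact norm_mul_le_left hs huv
      · exact norm_mul_le_left h4 (norm_mul_le_left hβ.le huv2)
      · refine norm_mul_le_left ?_ ht.le
        rw [norm_pow]; exact pow_le_one₀ (norm_nonneg _) (nonarch_sub_le hv1 hu1)
    · refine nonarch_add_le (norm_mul_le_left h4 (nonarch_add_le ?_ ?_))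
        (norm_mul_le_left hs huv2)
      · rw [pow_two, ← mul_assoc]; exact norm_mul_le_left huv hv1
      · rw [pow_two, mul_assoc]; exact norm_mul_le_left hu1 huv
  simp at this

theorem isNonsing_sub {P Q : G} (hP : IsNonsing X P) (hQ : IsNonsing X Q) :
    IsNonsing X (P - Q) :=
  sub_eq_add_neg P Q ▸ h.isNonsing_add hP (h.isNonsing_neg hQ)

/-- The absolute value of `X` is constant on a component other than the identity component and the
component of order `2`. -/
theorem norm_add_of_isNonsing {P Q : G} (hQ : IsNonsing X Q) (P0 : P ≠ 0) (hP : ‖X P‖ < 1)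
    (hb : ‖β‖ < ‖X P‖ ^ 2) : ‖X (Q + P)‖ = ‖X P‖ := by
  by_cases Q0 : Q = 0
  · simp [Q0]
  have hPs : ¬ IsNonsing X P := not_isNonsing.mpr ⟨P0, hP⟩
  have hQP : ¬ IsNonsing X (Q + P) := fun hh => hPs (by
    simpa using h.isNonsing_sub hh hQ)
  obtain ⟨QP0, ht⟩ := not_isNonsing.mp hQP
  have hy : 1 ≤ ‖X Q‖ := hQ.resolve_left Q0
  have y0 : X Q ≠ 0 := norm_pos_iff.mp (by linarith)
  have key := h.add_root Q0 P0 QP0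
  generalize X (Q + P) = t at *
  obtain ⟨v, hv⟩ : ∃ v, v = (X Q)⁻¹ := ⟨_, rfl⟩
  have hv1 : ‖v‖ ≤ 1 := by rw [hv, norm_inv]; exact inv_le_one_of_one_le₀ hy
  obtain ⟨x, hxdef⟩ : ∃ x, x = X P := ⟨_, rfl⟩
  rw [← hxdef] at key hP hb ⊢
  have key2 : (1 - x * v) ^ 2 * t ^ 2 -
      (x * (2 * (x * v + 1) + s * v) + 4 * β * v ^ 2) * t +
      (x ^ 2 - β * (4 * (v + x * v ^ 2) + s * v ^ 2)) = 0 := by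
    have : X Q = v⁻¹ := by simp [hv]
    rw [this] at key y0
    have v0 : v ≠ 0 := by simpa using y0
    field_simp at key
    linear_combination key
  have hs := h.norm_s.le
  have hβ := h.norm_β
  have h4 := norm_ofNat_le_one (K := K) 4
  have h2 := norm_ofNat_le_one (K := K) 2
  have hx0 : 0 < ‖x‖ := by
    by_contra hc
    have : ‖x‖ = 0 := le_antisymm (not_lt.mp hc) (norm_nonneg _)
    rw [this] at hb
    have := norm_nonneg β
    norm_num at hb
    linarith
  have hbx : ‖β‖ ≤ ‖x‖ := by nlinarith
  have hxv : ‖x * v‖ < 1 := by rw [mul_comm]; exact norm_mul_lt_left hv1 hP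
  have hv2 : ‖v ^ 2‖ ≤ 1 := by rw [norm_pow]; exact pow_le_one₀ (norm_nonneg _) hv1
  have hA : ‖(1 - x * v) ^ 2‖ = 1 := by
    rw [norm_pow, sub_eq_add_neg, nonarch_add_eq (by simpa using hxv)]; simp
  have hB : ‖x * (2 * (x * v + 1) + s * v) + 4 * β * v ^ 2‖ ≤ ‖x‖ := by
    refine nonarch_add_le ?_ ?_
    · rw [mul_comm]
      exact norm_mul_le_left (nonarch_add_le (norm_mul_le_left h2
        (nonarch_add_le hxv.le (by simp))) (norm_mul_le_left hs hv1)) le_rfl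
    · rw [mul_comm]
      exact norm_mul_le_left hv2 (norm_mul_le_left h4 hbx)
  have hC : ‖x ^ 2 - β * (4 * (v + x * v ^ 2) + s * v ^ 2)‖ = ‖x‖ ^ 2 := by
    rw [sub_eq_add_neg, nonarch_add_eq, norm_pow]
    rw [norm_neg, norm_pow, mul_comm]
    refine norm_mul_lt_left (nonarch_add_le (norm_mul_le_left h4 (nonarch_add_le hv1 ?_))
      (norm_mul_le_left hs hv2)) hb
    exact norm_mul_le_left hP.le hv2
  generalize (1 - x * v) ^ 2 = A at *
  generalize x * (2 * (x * v + 1) + s * v) + 4 * β * v ^ 2 = B at *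
  generalize x ^ 2 - β * (4 * (v + x * v ^ 2) + s * v ^ 2) = C at *
  rcases lt_trichotomy ‖t‖ ‖x‖ with hlt | heq | hgt
  · exfalso
    have e : C = (B - A * t) * t := by linear_combination key2
    have h1 : ‖B - A * t‖ ≤ ‖x‖ :=
      nonarch_sub_le hB (norm_mul_le_left hA.le hlt.le)
    have : ‖C‖ < ‖x‖ ^ 2 := by
      rw [e, norm_mul, pow_two]
      exact mul_lt_mul' h1 hlt (norm_nonneg _) hx0
    linarith
  · exact heq
  · exfalso
    have e : A * t ^ 2 = B * t - C := by linear_combination key2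
    have t0 : 0 < ‖t‖ := hx0.trans hgt
    have : ‖A * t ^ 2‖ < ‖t‖ ^ 2 := by
      rw [e]
      refine nonarch_sub_lt ?_ ?_
      · rw [norm_mul, pow_two]; exact mul_lt_mul_of_pos_right (hB.trans_lt hgt) t0
      · rw [hC]; exact pow_lt_pow_left₀ hgt (norm_nonneg _) two_ne_zero
    rw [norm_mul, norm_pow, hA, one_mul] at this
    exact this.false

/-- The points with `‖X‖ ^ 2 ≤ ‖β‖` lie on a single component, of order `2` in the component group. -/
theorem isNonsing_add_of_sq_le {P Q : G} (hP : ‖X P‖ ^ 2 ≤ ‖β‖) (hQ : ‖X Q‖ ^ 2 ≤ ‖β‖)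
    (P0 : P ≠ 0) (Q0 : Q ≠ 0) (β0 : β ≠ 0) : IsNonsing X (P + Q) := by
  by_contra hPQ
  obtain ⟨PQ0, ht⟩ := not_isNonsing.mp hPQ
  have key := h.add_root P0 Q0 PQ0
  generalize X (P + Q) = t at *
  obtain ⟨x, hx⟩ : ∃ x, x = X P := ⟨_, rfl⟩
  obtain ⟨y, hy⟩ : ∃ y, y = X Q := ⟨_, rfl⟩
  rw [← hx] at key hP
  rw [← hy] at key hQ
  have hs := h.norm_s
  have hβ := h.norm_β
  have b0 : 0 < ‖β‖ := norm_pos_iff.mpr β0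
  have h4 := norm_ofNat_le_one (K := K) 4
  have h2 := norm_ofNat_le_one (K := K) 2
  have hx1 : ‖x‖ < 1 := by
    by_contra hc
    nlinarith [not_lt.mp hc]
  have hy1 : ‖y‖ < 1 := by
    by_contra hc
    nlinarith [not_lt.mp hc]
  have hxy : ‖x * y‖ ≤ ‖β‖ := by
    rw [norm_mul]
    nlinarith [sq_nonneg (‖x‖ - ‖y‖)]
  have hD : ‖(x - y) ^ 2‖ ≤ ‖β‖ := by
    have : (x - y) ^ 2 = x ^ 2 + y ^ 2 - 2 * (x * y) := by ring
    rw [this]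
    exact nonarch_sub_le (nonarch_add_le (by simpa using hP) (by simpa using hQ))
      (norm_mul_le_left h2 hxy)
  have hS : ‖x * y * (2 * (x + y) + s) + 4 * β‖ ≤ ‖β‖ := by
    refine nonarch_add_le ?_ (norm_mul_le_left h4 le_rfl)
    rw [mul_comm]
    exact norm_mul_le_left (nonarch_add_le (norm_mul_le_left h2
      (nonarch_add_le hx1.le hy1.le)) hs.le) hxy
  have e : s * β = ((x - y) ^ 2 * t - (x * y * (2 * (x + y) + s) + 4 * β)) * t +
      ((x * y) * (x * y) - 4 * ((x + y) * β)) := by linear_combination -key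
  have hlt : ‖s * β‖ < ‖β‖ := by
    rw [e]
    refine nonarch_add_lt ?_ (nonarch_sub_lt ?_ (norm_mul_lt_left h4 ?_))
    · rw [norm_mul]
      have h1 : ‖(x - y) ^ 2 * t - (x * y * (2 * (x + y) + s) + 4 * β)‖ ≤ ‖β‖ :=
        nonarch_sub_le (by rw [mul_comm]; exact norm_mul_le_left ht.le hD) hS
      exact (mul_le_mul_of_nonneg_right h1 (norm_nonneg _)).trans_lt
        (mul_lt_of_lt_one_right b0 ht)
    · rw [norm_mul]
      nlinarith [norm_nonneg (x * y)]
    · rw [norm_mul]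
      exact mul_lt_of_lt_one_left b0 (nonarch_add_lt hx1 hy1)
  rw [norm_mul, hs, one_mul] at hlt
  exact hlt.false

/-- The absolute value of `X` determines the component of a point up to sign. -/
theorem isNonsing_add_or_sub {P Q : G} (P0 : P ≠ 0) (Q0 : Q ≠ 0) (hP : ‖X P‖ < 1)
    (hPQ : ‖X P‖ = ‖X Q‖) (hb : ‖β‖ < ‖X P‖ ^ 2) :
    IsNonsing X (P + Q) ∨ IsNonsing X (P - Q) := by
  by_cases PQ : P + Q = 0
  · exact .inl (.inl PQ)
  by_cases PQ' : P - Q = 0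
  · exact .inr (.inl PQ')
  have key := h.add_add_sub P0 Q0 PQ PQ'
  have hne : X P ≠ X Q := fun e => (h.eq_or_eq_neg P0 Q0 e).elim
    (fun e => PQ' (sub_eq_zero.mpr e)) (fun e => PQ (by rw [e, neg_add_cancel]))
  by_contra! hcon
  obtain ⟨-, ht1⟩ := not_isNonsing.mp hcon.1
  obtain ⟨-, ht2⟩ := not_isNonsing.mp hcon.2
  have h4 := norm_ofNat_le_one (K := K) 4
  have h2 := norm_ofNat_le_one (K := K) 2
  have hs := h.norm_s
  have hS : ‖X P * X Q * (2 * (X P + X Q) + s) + 4 * β‖ = ‖X P‖ ^ 2 := by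
    have h1 : ‖2 * (X P + X Q) + s‖ = 1 := by
      rw [add_comm, nonarch_add_eq, hs]
      rw [hs]
      exact norm_mul_lt_left h2 (nonarch_add_lt hP (hPQ ▸ hP))
    have h5 : ‖X P * X Q * (2 * (X P + X Q) + s)‖ = ‖X P‖ ^ 2 := by
      rw [norm_mul, h1, norm_mul, ← hPQ]; ring
    rw [nonarch_add_eq, h5]
    rw [h5]
    exact norm_mul_lt_left h4 hb
  have hD : ‖(X P - X Q) ^ 2‖ ≤ ‖X P‖ ^ 2 := by
    rw [norm_pow]
    exact pow_le_pow_left₀ (norm_nonneg _) (nonarch_sub_le le_rfl hPQ.ge) 2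
  have hD0 : 0 < ‖(X P - X Q) ^ 2‖ := norm_pos_iff.mpr (pow_ne_zero 2 (sub_ne_zero.mpr hne))
  rw [← key, norm_mul] at hS
  nlinarith [nonarch_add_lt ht1 ht2]

/-- The absolute value of `X` on the components of order `3`. -/
theorem norm_pow_three_of_three_nsmul {P : G} (β0 : β ≠ 0) (hP : ¬ IsNonsing X P)
    (h3 : IsNonsing X (3 • P)) : ‖X P‖ ^ 3 = ‖β‖ := by
  have hP2 : ¬ IsNonsing X (P + P) := fun h2 => hP (by
    have := h.isNonsing_sub h3 h2
    rwa [show 3 • P - (P + P) = P by abel] at this)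
  obtain ⟨P0, hx⟩ := not_isNonsing.mp hP
  obtain ⟨PP0, ht⟩ := not_isNonsing.mp hP2
  have hb : ‖β‖ < ‖X P‖ ^ 2 := by
    by_contra hc
    exact hP2 (h.isNonsing_add_of_sq_le (not_lt.mp hc) (not_lt.mp hc) P0 P0 β0)
  have ht' : ‖X (P + P)‖ = ‖X P‖ := by
    have := h.norm_add_of_isNonsing (P := -P) h3 (neg_ne_zero.mpr P0)
      (by rwa [h.map_neg]) (by rwa [h.map_neg])
    rwa [h.map_neg, show 3 • P + -P = P + P by abel] at this
  have key := h.add_root P0 P0 PP0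
  generalize X (P + P) = t at *
  obtain ⟨x, hxdef⟩ : ∃ x, x = X P := ⟨_, rfl⟩
  rw [← hxdef] at hx hb ht' key ⊢
  have h8 := norm_ofNat_le_one (K := K) 8
  have h4 := norm_ofNat_le_one (K := K) 4
  have h2 := norm_ofNat_le_one (K := K) 2
  have hs := h.norm_s
  have b0 : 0 < ‖β‖ := norm_pos_iff.mpr β0
  have hx0 : 0 < ‖x‖ := by
    by_contra hc
    have : ‖x‖ = 0 := le_antisymm (not_lt.mp hc) (norm_nonneg _)
    rw [this] at hb
    norm_num at hb
    linarith
  have hS : ‖x * x * (2 * (x + x) + s) + 4 * β‖ = ‖x‖ ^ 2 := by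
    have h1 : ‖2 * (x + x) + s‖ = 1 := by
      rw [add_comm, nonarch_add_eq, hs]
      rw [hs]
      exact norm_mul_lt_left h2 (nonarch_add_lt hx hx)
    have h5 : ‖x * x * (2 * (x + x) + s)‖ = ‖x‖ ^ 2 := by
      rw [norm_mul, h1, norm_mul]; ring
    rw [nonarch_add_eq, h5]
    rw [h5]
    exact norm_mul_lt_left h4 hb
  have e : (x * x * (2 * (x + x) + s) + 4 * β) * t = x ^ 4 - (8 * x + s) * β := by
    linear_combination -key
  have hs8 : ‖8 * x + s‖ = 1 := by
    rw [add_comm, nonarch_add_eq, hs]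
    rw [hs]
    exact norm_mul_lt_left h8 hx
  have hbn : ‖-((8 * x + s) * β)‖ = ‖β‖ := by rw [norm_neg, norm_mul, hs8, one_mul]
  have hn : ‖x ^ 4 - (8 * x + s) * β‖ = ‖x‖ ^ 3 := by
    rw [← e, norm_mul, hS, ht']; ring
  have hlt : ‖x‖ ^ 4 < ‖x‖ ^ 3 := pow_lt_pow_right_of_lt_one₀ hx0 hx (by norm_num)
  rw [sub_eq_add_neg] at hn
  rcases lt_or_ge (‖x‖ ^ 4) ‖β‖ with h1 | h1
  · rw [add_comm, nonarch_add_eq (by rwa [hbn, norm_pow]), hbn] at hn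
    exact hn.symm
  · have := nonarch_add_le (a := x ^ 4) (b := -((8 * x + s) * β)) (c := ‖x‖ ^ 4)
      (norm_pow x 4).le (by rwa [hbn])
    linarith

/-- If `‖β‖ = q ^ n` with `3 ∤ n` and the multiples of `Q` have their `X`-coordinate of absolute
value in `q ^ ℤ` or zero, then the component of `Q` has finite order prime to `3`. -/
theorem exists_nsmul_isNonsing {q : ℝ} (hq0 : 0 < q) (hq1 : q < 1) {n : ℕ} (hn : ¬ 3 ∣ n)
    (hβ : ‖β‖ = q ^ n) (Q : G) (hQ : ∀ j : ℕ, X (j • Q) ≠ 0 → ∃ k : ℤ, ‖X (j • Q)‖ = q ^ k) :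
    ∃ m : ℕ, ¬ 3 ∣ m ∧ IsNonsing X (m • Q) := by
  have β0 : β ≠ 0 := norm_pos_iff.mp (hβ ▸ pow_pos hq0 n)
  have hex : ∃ m : ℕ, 0 < m ∧ IsNonsing X (m • Q) := by
    by_contra! hcon
    have hns : ∀ j : ℕ, (j + 1) • Q ≠ 0 ∧ ‖X ((j + 1) • Q)‖ < 1 :=
      fun j => not_isNonsing.mp (hcon (j + 1) j.succ_pos)
    -- the component of `(j + 1) • Q`, up to sign
    have hk : ∀ j : ℕ, ∃ k : Fin (n + 1),
        (‖X ((j + 1) • Q)‖ ^ 2 ≤ ‖β‖ ∧ k = Fin.last n) ∨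
        (‖β‖ < ‖X ((j + 1) • Q)‖ ^ 2 ∧ (k : ℕ) ≠ n ∧ ‖X ((j + 1) • Q)‖ = q ^ (k : ℕ)) := by
      intro j
      rcases le_or_gt (‖X ((j + 1) • Q)‖ ^ 2) ‖β‖ with hle | hgt
      · exact ⟨Fin.last n, .inl ⟨hle, rfl⟩⟩
      · obtain ⟨k, hk⟩ := hQ (j + 1) (fun h0 => by
          rw [h0, norm_zero, zero_pow two_ne_zero] at hgt
          exact absurd hgt (not_lt.mpr (norm_nonneg _)))
        have hk0 : 0 < k := by
          have := (hns j).2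
          rw [hk] at this
          by_contra hc
          exact absurd (one_le_zpow_of_nonpos₀ hq0 hq1.le (not_lt.mp hc)) (not_le.mpr this)
        lift k to ℕ using hk0.le
        rw [zpow_natCast] at hk
        have : 2 * k < n := by
          rw [hβ, hk, ← pow_mul, mul_comm] at hgt
          exact (pow_lt_pow_iff_right_of_lt_one₀ hq0 hq1).mp hgt
        exact ⟨⟨k, by omega⟩, .inr ⟨hgt, by simp; omega, hk⟩⟩
    choose c hc using hk
    obtain ⟨i, j, hij, hcij⟩ := Finite.exists_ne_map_eq_of_infinite c
    wlog hlt : i < j generalizing i j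
    · exact this j i hij.symm hcij.symm (by omega)
    have hor : IsNonsing X ((j + 1) • Q + (i + 1) • Q) ∨
        IsNonsing X ((j + 1) • Q - (i + 1) • Q) := by
      rcases hc i with ⟨hi, hi'⟩ | ⟨hi, hi', hi''⟩ <;>
        rcases hc j with ⟨hj, hj'⟩ | ⟨hj, hj', hj''⟩
      · exact .inl (h.isNonsing_add_of_sq_le hj hi (hns j).1 (hns i).1 β0)
      · exact absurd (by rw [← hcij, hi']; rfl) hj'
      · exact absurd (by rw [hcij, hj']; rfl) hi'
      · exact h.isNonsing_add_or_sub (hns j).1 (hns i).1 (hns j).2 (by rw [hi'', hj'', hcij]) hj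
    rcases hor with hor | hor
    · refine hcon (j + 1 + (i + 1)) (by omega) ?_
      rwa [add_smul]
    · refine hcon (j - i) (by omega) ?_
      have : (j + 1) • Q - (i + 1) • Q = (j - i) • Q := by
        rw [sub_eq_iff_eq_add, ← add_smul]; congr 1; omega
      rwa [this] at hor
  classical
  obtain ⟨hm0, hm⟩ := Nat.find_spec hex
  refine ⟨Nat.find hex, ?_, hm⟩
  rintro ⟨m', hm'⟩
  have hlt : m' < Nat.find hex := by omega
  have hm'0 : 0 < m' := by omega
  have hns : ¬ IsNonsing X (m' • Q) := fun hh => Nat.find_min hex hlt ⟨hm'0, hh⟩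
  rw [hm', mul_smul] at hm
  have h3 := h.norm_pow_three_of_three_nsmul β0 hns hm
  obtain ⟨k, hk⟩ := hQ m' (fun h0 => by
    rw [h0, norm_zero, zero_pow three_ne_zero] at h3
    exact β0 (norm_eq_zero.mp h3.symm))
  rw [hk, hβ, ← zpow_natCast, ← zpow_mul, ← zpow_natCast] at h3
  have := zpow_right_injective₀ hq0 hq1.ne h3
  apply hn
  have : (3 : ℤ) ∣ n := ⟨k, by rw [← this]; push_cast; ring⟩
  exact_mod_cast this

/-- If the multiples of `3 • P` have their `X`-coordinate of absolute value in `q ^ ℤ` or zero, then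
some multiple of `P`, prime to `3`, has nonsingular reduction after translation by a point of order
dividing `3`. -/
theorem exists_nsmul_add_isNonsing {q : ℝ} (hq0 : 0 < q) (hq1 : q < 1) {n : ℕ} (hn : ¬ 3 ∣ n)
    (hβ : ‖β‖ = q ^ n) {T : G} (hT : 3 • T = 0) (T0 : T ≠ 0) (hT1 : ‖X T‖ ^ 3 = ‖β‖) (P : G)
    (hP : ∀ j : ℕ, X (j • 3 • P) ≠ 0 → ∃ k : ℤ, ‖X (j • 3 • P)‖ = q ^ k) :
    ∃ (m : ℕ) (T' : G), ¬ 3 ∣ m ∧ 3 • T' = 0 ∧ IsNonsing X (m • P + T') := by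
  have β0 : 0 < ‖β‖ := hβ ▸ pow_pos hq0 n
  obtain ⟨m, hm, hmP⟩ := h.exists_nsmul_isNonsing hq0 hq1 hn hβ _ hP
  rw [smul_comm] at hmP
  by_cases hP0 : IsNonsing X (m • P)
  · exact ⟨m, 0, hm, smul_zero _, by rwa [add_zero]⟩
  have h1 := h.norm_pow_three_of_three_nsmul (norm_pos_iff.mp β0) hP0 hmP
  obtain ⟨mP0, hlt⟩ := not_isNonsing.mp hP0
  have heq : ‖X (m • P)‖ = ‖X T‖ :=
    (pow_left_inj₀ (norm_nonneg _) (norm_nonneg _) three_ne_zero).mp (h1.trans hT1.symm)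
  have hpos : 0 < ‖X (m • P)‖ := by
    by_contra hc
    rw [le_antisymm (not_lt.mp hc) (norm_nonneg _)] at h1
    norm_num at h1
    linarith
  have hb : ‖β‖ < ‖X (m • P)‖ ^ 2 :=
    h1 ▸ pow_lt_pow_right_of_lt_one₀ hpos hlt (by norm_num)
  rcases h.isNonsing_add_or_sub mP0 T0 hlt heq hb with h2 | h2
  · exact ⟨m, T, hm, hT, h2⟩
  · exact ⟨m, -T, hm, by rw [smul_neg, hT, neg_zero], by rwa [← sub_eq_add_neg]⟩

end NodalCoordinate

namespace WeierstrassCurve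

section AdditionFormulas

/-! ### The `x`-coordinates of sums and differences of points -/

variable {K : Type*} [Field K]

/-- The `x`-coordinate of a point, with the value `0` at infinity. -/
def Affine.Point.xCoord {V : WeierstrassCurve K} : V.toAffine.Point → K
  | .zero => 0
  | .some x _ _ => x

open Affine.Point (xCoord)

variable {V : WeierstrassCurve K} (h₁ : V.a₁ = 0) (h₃ : V.a₃ = 0)

theorem xCoord_neg (P : V.toAffine.Point) : xCoord (-P) = xCoord P := by
  cases P <;> rfl

theorem eq_or_eq_neg_of_xCoord_eq [DecidableEq K] {P Q : V.toAffine.Point} (hP : P ≠ 0) (hQ : Q ≠ 0)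
    (h : xCoord P = xCoord Q) : P = Q ∨ P = -Q := by
  rcases P with _ | ⟨x, y, hxy⟩
  · exact absurd rfl hP
  rcases Q with _ | ⟨x', y', hxy'⟩
  · exact absurd rfl hQ
  exact Affine.Point.X_eq_iff.mp h

include h₁ h₃

theorem equation_of_nonsingular {x y : K} (h : V.toAffine.Nonsingular x y) :
    y ^ 2 = x ^ 3 + V.a₂ * x ^ 2 + V.a₄ * x + V.a₆ := by
  have := (Affine.equation_iff _ _).mp h.1
  rw [h₁, h₃] at this
  linear_combination this

variable [DecidableEq K]

/-- `x(P + Q)` is a root of the quadratic polynomial whose roots are `x(P + Q)` and `x(P - Q)`. -/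
theorem xCoord_add_root {P Q : V.toAffine.Point} (hP : P ≠ 0) (hQ : Q ≠ 0) (hPQ : P + Q ≠ 0) :
    (xCoord P - xCoord Q) ^ 2 * xCoord (P + Q) ^ 2 -
      (2 * xCoord P * xCoord Q * (xCoord P + xCoord Q) + V.b₂ * (xCoord P * xCoord Q) +
        V.b₄ * (xCoord P + xCoord Q) + V.b₆) * xCoord (P + Q) +
      (xCoord P ^ 2 * xCoord Q ^ 2 - V.b₄ * (xCoord P * xCoord Q) -
        V.b₆ * (xCoord P + xCoord Q) - V.b₈) = 0 := by
  rcases P with _ | ⟨x, y, hxy⟩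
  · exact absurd rfl hP
  rcases Q with _ | ⟨x', y', hxy'⟩
  · exact absurd rfl hQ
  have hne : ¬(x = x' ∧ y = V.toAffine.negY x' y') :=
    fun hh => hPQ (Affine.Point.add_of_Y_eq hh.1 hh.2)
  rw [Affine.Point.add_some hne]
  have e := equation_of_nonsingular h₁ h₃ hxy
  have e' := equation_of_nonsingular h₁ h₃ hxy'
  simp only [xCoord, Affine.addX, h₁, b₂, b₄, b₆, b₈, h₃]
  by_cases hx : x = x'
  · subst hx
    have hy : y ≠ V.toAffine.negY x y' := fun h => hne ⟨rfl, h⟩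
    rw [Affine.slope_of_Y_ne rfl hy]
    have hyy : y = y' := (Affine.Y_eq_of_X_eq hxy.1 hxy'.1 rfl).resolve_right hy
    subst hyy
    simp only [Affine.negY, h₁, h₃, zero_mul, sub_zero, sub_neg_eq_add] at hy ⊢
    have hy2 : y + y ≠ 0 := fun h => hy (eq_neg_of_add_eq_zero_left h)
    obtain ⟨l, hl⟩ : ∃ l, l = (3 * x ^ 2 + 2 * V.a₂ * x + V.a₄) / (y + y) := ⟨_, rfl⟩
    rw [← hl]
    rw [eq_div_iff hy2] at hl
    linear_combination (-(l * (y + y) + (3 * x ^ 2 + 2 * V.a₂ * x + V.a₄))) * hl +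
      4 * l ^ 2 * e
  · rw [Affine.slope_of_X_ne hx]
    have hx' : x - x' ≠ 0 := sub_ne_zero.mpr hx
    obtain ⟨l, hl⟩ : ∃ l, l = (y - y') / (x - x') := ⟨_, rfl⟩
    rw [← hl]
    rw [eq_div_iff hx'] at hl
    have hy : y = y' + l * (x - x') := by rw [hl]; ring
    have hD : (x - x') ^ 2 ≠ 0 := pow_ne_zero 2 hx'
    apply mul_left_cancel₀ hD
    obtain ⟨D, hDd⟩ : ∃ D, D = (x - x') ^ 2 := ⟨_, rfl⟩
    have hN : D * (l ^ 2 - V.a₂ - x - x') = (y - y') ^ 2 - (V.a₂ + x + x') * D := by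
      rw [hDd, ← hl]; ring
    obtain ⟨t, ht⟩ : ∃ t, t = l ^ 2 - V.a₂ - x - x' := ⟨_, rfl⟩
    simp only [zero_mul, add_zero]
    rw [← ht] at hN ⊢
    rw [← hDd]
    set S := 2 * x * x' * (x + x') + (0 ^ 2 + 4 * V.a₂) * (x * x') +
      (2 * V.a₄ + 0) * (x + x') + (0 ^ 2 + 4 * V.a₆) with hS
    set M := x ^ 2 * x' ^ 2 - (2 * V.a₄ + 0) * (x * x') -
        (0 ^ 2 + 4 * V.a₆) * (x + x') -
        (0 ^ 2 * V.a₆ + 4 * V.a₂ * V.a₆ - 0 * V.a₄ + V.a₂ * 0 ^ 2 - V.a₄ ^ 2) with hM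
    set N := (y - y') ^ 2 - (V.a₂ + x + x') * D with hNd
    suffices N ^ 2 - S * N + M * D = 0 by
      linear_combination this + (D * t + N - S) * hN
    simp only [hNd, hS, hM, hDd]
    linear_combination
      ((y ^ 2 - (x ^ 3 + V.a₂ * x ^ 2 + V.a₄ * x + V.a₆)) +
        (y' ^ 2 - (x' ^ 3 + V.a₂ * x' ^ 2 + V.a₄ * x' + V.a₆)) - 4 * y * y') * (e + e') +
      4 * y' ^ 2 * e + 4 * (x ^ 3 + V.a₂ * x ^ 2 + V.a₄ * x + V.a₆) * e'

/-- For `x(P) ≠ x(Q)` this is the formula for the slope of the line through `P` and `-Q`; for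
`P = -Q` both sides vanish. -/
theorem sq_sub_mul_xCoord_sub {x y x' y' : K} {h : V.toAffine.Nonsingular x y}
    {h' : V.toAffine.Nonsingular x' y'}
    (hne : Affine.Point.some x y h ≠ Affine.Point.some x' y' h') :
    (x - x') ^ 2 * xCoord (Affine.Point.some x y h - Affine.Point.some x' y' h') =
      (y + y') ^ 2 - (V.a₂ + x + x') * (x - x') ^ 2 := by
  have hneg : V.toAffine.negY x' y' = -y' := by simp [Affine.negY, h₁, h₃]
  by_cases hx : x = x'
  · subst hx
    have hy : y = V.toAffine.negY x y' := (Affine.Y_eq_of_X_eq h.1 h'.1 rfl).resolve_left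
      (fun hy => hne (by subst hy; rfl))
    rw [sub_self, show y + y' = 0 by rw [hy, hneg, neg_add_cancel]]
    ring
  · have hx' : x - x' ≠ 0 := sub_ne_zero.mpr hx
    rw [sub_eq_add_neg (Affine.Point.some x y h), Affine.Point.neg_some,
      Affine.Point.add_some (fun hh => hx hh.1)]
    simp only [xCoord, Affine.addX, h₁, Affine.slope_of_X_ne hx, hneg]
    field_simp
    ring

theorem sq_sub_mul_xCoord_add_add_sub {P Q : V.toAffine.Point} (hP : P ≠ 0) (hQ : Q ≠ 0)
    (hPQ : P + Q ≠ 0) (hPQ' : P - Q ≠ 0) :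
    (xCoord P - xCoord Q) ^ 2 * (xCoord (P + Q) + xCoord (P - Q)) =
      2 * xCoord P * xCoord Q * (xCoord P + xCoord Q) + V.b₂ * (xCoord P * xCoord Q) +
        V.b₄ * (xCoord P + xCoord Q) + V.b₆ := by
  rcases P with _ | ⟨x, y, hxy⟩
  · exact absurd rfl hP
  rcases Q with _ | ⟨x', y', hxy'⟩
  · exact absurd rfl hQ
  have e := equation_of_nonsingular h₁ h₃ hxy
  have e' := equation_of_nonsingular h₁ h₃ hxy'
  have s1 := sq_sub_mul_xCoord_sub h₁ h₃ (sub_ne_zero.mp hPQ')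
  have s2 := sq_sub_mul_xCoord_sub h₁ h₃ (h := hxy)
    (h' := (Affine.nonsingular_neg x' y').mpr hxy') (fun hh => hPQ (by
      rw [hh, ← Affine.Point.neg_some hxy', neg_add_cancel]))
  rw [← Affine.Point.neg_some hxy', sub_neg_eq_add] at s2
  simp only [Affine.negY, h₁, h₃] at s2
  change (x - x') ^ 2 * _ = _
  rw [mul_add, s1, s2]
  simp only [xCoord, b₂, b₄, b₆, h₁, h₃]
  linear_combination 2 * e + 2 * e'

theorem three_torsion_xCoord {P : V.toAffine.Point} (hP : P ≠ 0) (h3 : (3 : ℕ) • P = 0) :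
    3 * xCoord P ^ 4 + V.b₂ * xCoord P ^ 3 + 3 * V.b₄ * xCoord P ^ 2 + 3 * V.b₆ * xCoord P + V.b₈ =
      0 := by
  have hPP : P + P = -P := by
    rw [eq_neg_iff_add_eq_zero, ← h3]; abel
  have := xCoord_add_root h₁ h₃ hP hP (by rw [hPP]; exact neg_ne_zero.mpr hP)
  rw [hPP, xCoord_neg] at this
  linear_combination -this

/-- A point whose `x`-coordinate is a root of the third division polynomial is killed by `3`. -/
theorem three_nsmul_eq_zero {P : V.toAffine.Point} (hPP : P + P ≠ 0)
    (hψ : 3 * xCoord P ^ 4 + V.b₂ * xCoord P ^ 3 + 3 * V.b₄ * xCoord P ^ 2 + 3 * V.b₆ * xCoord P +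
      V.b₈ = 0)
    (hS : 4 * xCoord P ^ 3 + V.b₂ * xCoord P ^ 2 + 2 * V.b₄ * xCoord P + V.b₆ ≠ 0) :
    (3 : ℕ) • P = 0 := by
  have hP : P ≠ 0 := fun h => hPP (by simp [h])
  have := xCoord_add_root h₁ h₃ hP hP hPP
  have hx : xCoord (P + P) = xCoord P := by
    apply mul_left_cancel₀ hS
    linear_combination -this - hψ
  rcases eq_or_eq_neg_of_xCoord_eq hPP hP hx with h | h
  · exact absurd (by simpa using h) hP
  · rw [show (3 : ℕ) • P = P + P + P by abel, h, neg_add_cancel]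

end AdditionFormulas

section Twist

/-! ### Quadratic twists -/

variable {K : Type*} [Field K] (C : WeierstrassCurve K) (d : K)

theorem quadTwist_b₂ (h2 : (2 : K) ≠ 0) : (C.quadTwist d).b₂ = d * C.b₂ := by
  have : (4 : K) ≠ 0 := by rw [show (4 : K) = 2 * 2 by norm_num]; exact mul_ne_zero h2 h2
  simp only [quadTwist, b₂]; field_simp; ring

theorem quadTwist_b₄ (h2 : (2 : K) ≠ 0) : (C.quadTwist d).b₄ = d ^ 2 * C.b₄ := by
  simp only [quadTwist, b₄]; field_simp; ring

theorem quadTwist_b₆ (h2 : (2 : K) ≠ 0) : (C.quadTwist d).b₆ = d ^ 3 * C.b₆ := by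
  have : (4 : K) ≠ 0 := by rw [show (4 : K) = 2 * 2 by norm_num]; exact mul_ne_zero h2 h2
  simp only [quadTwist, b₆]; field_simp; ring

theorem quadTwist_b₈ (h2 : (2 : K) ≠ 0) : (C.quadTwist d).b₈ = d ^ 4 * C.b₈ := by
  have h4 : (4 : K) ≠ 0 := by rw [show (4 : K) = 2 * 2 by norm_num]; exact mul_ne_zero h2 h2
  have r1 := C.b_relation
  have r2 := (C.quadTwist d).b_relation
  rw [quadTwist_b₂ C d h2, quadTwist_b₄ C d h2, quadTwist_b₆ C d h2] at r2
  apply mul_left_cancel₀ h4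
  linear_combination r2 - d ^ 4 * r1

theorem map_quadTwist {L : Type*} [Field L] (f : K →+* L) :
    (C.quadTwist d).map f = (C.map f).quadTwist (f d) := by
  ext <;> simp [quadTwist, map_b₂, map_b₄, map_b₆, map_ofNat f]

end Twist

end WeierstrassCurve

namespace WeierstrassCurve

open Affine.Point (xCoord)

section TwistedCoordinate

variable {K : Type*} [Field K] [DecidableEq K] {C : WeierstrassCurve K} {d : K}

/-- The function `x / d` on the quadratic twist of a curve `C` by `d`. Over a field that contains a
square root of `d` the twist is isomorphic to `C`, and this is the `x`-coordinate of `C`. -/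
def twistX (C : WeierstrassCurve K) (d : K) (P : (C.quadTwist d).toAffine.Point) : K :=
  xCoord P / d

variable (hd : d ≠ 0)

omit [DecidableEq K] in
include hd in
theorem xCoord_eq_mul_twistX (P : (C.quadTwist d).toAffine.Point) :
    xCoord P = d * twistX C d P := by
  rw [twistX, mul_div_cancel₀ _ hd]

omit [DecidableEq K] in
theorem twistX_neg (P : (C.quadTwist d).toAffine.Point) : twistX C d (-P) = twistX C d P := by
  rw [twistX, xCoord_neg, twistX]

include hd

theorem eq_or_eq_neg_of_twistX_eq {P Q : (C.quadTwist d).toAffine.Point} (hP : P ≠ 0) (hQ : Q ≠ 0)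
    (h : twistX C d P = twistX C d Q) : P = Q ∨ P = -Q :=
  eq_or_eq_neg_of_xCoord_eq hP hQ (by rw [xCoord_eq_mul_twistX hd, h, ← xCoord_eq_mul_twistX hd])

variable (h2 : (2 : K) ≠ 0)

include h2

theorem twistX_add_root {P Q : (C.quadTwist d).toAffine.Point} (hP : P ≠ 0) (hQ : Q ≠ 0)
    (hPQ : P + Q ≠ 0) :
    (twistX C d P - twistX C d Q) ^ 2 * twistX C d (P + Q) ^ 2 -
      (2 * twistX C d P * twistX C d Q * (twistX C d P + twistX C d Q) +
        C.b₂ * (twistX C d P * twistX C d Q) + C.b₄ * (twistX C d P + twistX C d Q) + C.b₆) *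
          twistX C d (P + Q) +
      (twistX C d P ^ 2 * twistX C d Q ^ 2 - C.b₄ * (twistX C d P * twistX C d Q) -
        C.b₆ * (twistX C d P + twistX C d Q) - C.b₈) = 0 := by
  have := xCoord_add_root rfl rfl hP hQ hPQ
  rw [quadTwist_b₂ C d h2, quadTwist_b₄ C d h2, quadTwist_b₆ C d h2, quadTwist_b₈ C d h2] at this
  simp only [xCoord_eq_mul_twistX hd] at this
  apply mul_left_cancel₀ (pow_ne_zero 4 hd)
  linear_combination this

theorem twistX_add_add_sub {P Q : (C.quadTwist d).toAffine.Point} (hP : P ≠ 0) (hQ : Q ≠ 0)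
    (hPQ : P + Q ≠ 0) (hPQ' : P - Q ≠ 0) :
    (twistX C d P - twistX C d Q) ^ 2 * (twistX C d (P + Q) + twistX C d (P - Q)) =
      2 * twistX C d P * twistX C d Q * (twistX C d P + twistX C d Q) +
        C.b₂ * (twistX C d P * twistX C d Q) + C.b₄ * (twistX C d P + twistX C d Q) + C.b₆ := by
  have := sq_sub_mul_xCoord_add_add_sub rfl rfl hP hQ hPQ hPQ'
  rw [quadTwist_b₂ C d h2, quadTwist_b₄ C d h2, quadTwist_b₆ C d h2] at this
  simp only [xCoord_eq_mul_twistX hd] at this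
  apply mul_left_cancel₀ (pow_ne_zero 3 hd)
  linear_combination this

theorem three_torsion_twistX {P : (C.quadTwist d).toAffine.Point} (hP : P ≠ 0)
    (h3 : (3 : ℕ) • P = 0) :
    3 * twistX C d P ^ 4 + C.b₂ * twistX C d P ^ 3 + 3 * C.b₄ * twistX C d P ^ 2 +
      3 * C.b₆ * twistX C d P + C.b₈ = 0 := by
  have := three_torsion_xCoord rfl rfl hP h3
  rw [quadTwist_b₂ C d h2, quadTwist_b₄ C d h2, quadTwist_b₆ C d h2, quadTwist_b₈ C d h2] at this
  simp only [xCoord_eq_mul_twistX hd] at this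
  apply mul_left_cancel₀ (pow_ne_zero 4 hd)
  linear_combination this

omit hd [DecidableEq K] in
/-- In the coordinates `ξ = x / e ^ 2`, `η`, the twist by `e ^ 2` satisfies the equation of `C`. -/
theorem equation_of_quadTwist {e : K} (he : e ≠ 0) {x y ξ η : K}
    (h : (C.quadTwist (e ^ 2)).toAffine.Nonsingular x y) (hξ : x = e ^ 2 * ξ)
    (hη : 2 * y = e ^ 3 * (2 * η + C.a₁ * ξ + C.a₃)) :
    η ^ 2 + (C.a₁ * ξ + C.a₃) * η = ξ ^ 3 + C.a₂ * ξ ^ 2 + C.a₄ * ξ + C.a₆ := by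
  have h4 : (4 : K) ≠ 0 := by rw [show (4 : K) = 2 * 2 by norm_num]; exact mul_ne_zero h2 h2
  have e1 := equation_of_nonsingular rfl rfl h
  simp only [quadTwist, b₂, b₄, b₆] at e1
  rw [hξ] at e1
  field_simp at e1
  apply mul_left_cancel₀ (mul_ne_zero (mul_ne_zero h4 h2) (pow_ne_zero 6 he))
  linear_combination e1 - 2 * (2 * y + e ^ 3 * (2 * η + C.a₁ * ξ + C.a₃)) * hη

omit hd in
/-- The formula for the slope on `C`, in coordinates on the twist by `e ^ 2`. -/
theorem sq_sub_mul_twistX_sub {e : K} (he : e ≠ 0) {x y ξ η x' y' ξ' η' : K}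
    {h : (C.quadTwist (e ^ 2)).toAffine.Nonsingular x y}
    {h' : (C.quadTwist (e ^ 2)).toAffine.Nonsingular x' y'}
    (hξ : x = e ^ 2 * ξ) (hη : 2 * y = e ^ 3 * (2 * η + C.a₁ * ξ + C.a₃))
    (hξ' : x' = e ^ 2 * ξ') (hη' : 2 * y' = e ^ 3 * (2 * η' + C.a₁ * ξ' + C.a₃))
    (hne : Affine.Point.some x y h ≠ Affine.Point.some x' y' h') :
    (ξ - ξ') ^ 2 * twistX C (e ^ 2) (Affine.Point.some x y h - Affine.Point.some x' y' h') =
      (η + η' + C.a₁ * ξ' + C.a₃) ^ 2 + C.a₁ * (η + η' + C.a₁ * ξ' + C.a₃) * (ξ - ξ') -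
        (C.a₂ + ξ + ξ') * (ξ - ξ') ^ 2 := by
  have h4 : (4 : K) ≠ 0 := by rw [show (4 : K) = 2 * 2 by norm_num]; exact mul_ne_zero h2 h2
  have e1 := sq_sub_mul_xCoord_sub rfl rfl hne
  rw [xCoord_eq_mul_twistX (pow_ne_zero 2 he)] at e1
  generalize twistX C (e ^ 2) _ = t at *
  rw [hξ, hξ'] at e1
  simp only [quadTwist, b₂] at e1
  field_simp at e1
  apply mul_left_cancel₀ (mul_ne_zero h4 (pow_ne_zero 6 he))
  linear_combination e1 + (2 * (y + y') + e ^ 3 * (2 * (η + η') + C.a₁ * (ξ + ξ') + 2 * C.a₃)) *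
    (hη + hη')

end TwistedCoordinate

section Separation

/-! ### Points of nonsingular reduction that are congruent modulo `3`-torsion -/

variable {K : Type*} [NormedField K] [IsUltrametricDist K]

/-- The coefficients of the curve are integral. -/
structure IntegralCoeffs (C : WeierstrassCurve K) : Prop where
  a₁ : ‖C.a₁‖ ≤ 1
  a₂ : ‖C.a₂‖ ≤ 1
  a₃ : ‖C.a₃‖ ≤ 1
  a₄ : ‖C.a₄‖ ≤ 1
  a₆ : ‖C.a₆‖ ≤ 1

namespace IntegralCoeffs

variable {C : WeierstrassCurve K} (h : C.IntegralCoeffs)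

include h

theorem b₂ : ‖C.b₂‖ ≤ 1 :=
  nonarch_add_le (norm_pow_le_one h.a₁ 2) (norm_mul_le_left (norm_ofNat_le_one 4) h.a₂)

theorem b₄ : ‖C.b₄‖ ≤ 1 :=
  nonarch_add_le (norm_mul_le_left (norm_ofNat_le_one 2) h.a₄) (norm_mul_le_left h.a₁ h.a₃)

theorem b₆ : ‖C.b₆‖ ≤ 1 :=
  nonarch_add_le (norm_pow_le_one h.a₃ 2) (norm_mul_le_left (norm_ofNat_le_one 4) h.a₆)

theorem b₈ : ‖C.b₈‖ ≤ 1 :=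
  nonarch_sub_le (nonarch_add_le (nonarch_sub_le (nonarch_add_le
    (norm_mul_le_left (norm_pow_le_one h.a₁ 2) h.a₆)
    (norm_mul_le_left (norm_mul_le_left (norm_ofNat_le_one 4) h.a₂) h.a₆))
    (norm_mul_le_left (norm_mul_le_left h.a₁ h.a₃) h.a₄))
    (norm_mul_le_left h.a₂ (norm_pow_le_one h.a₃ 2))) (norm_pow_le_one h.a₄ 2)

/-- The points of order `3` are integral if `3` is a unit. -/
theorem norm_le_one_of_three_torsion (h3 : ‖(3 : K)‖ = 1) {t : K}
    (ht : 3 * t ^ 4 + C.b₂ * t ^ 3 + 3 * C.b₄ * t ^ 2 + 3 * C.b₆ * t + C.b₈ = 0) : ‖t‖ ≤ 1 := by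
  by_contra! hc
  have t0 : t ≠ 0 := norm_pos_iff.mp (by linarith)
  obtain ⟨w, hw⟩ : ∃ w, w = t⁻¹ := ⟨_, rfl⟩
  have hw1 : ‖w‖ < 1 := by rw [hw, norm_inv]; exact inv_lt_one_of_one_lt₀ hc
  have e : (3 : K) = -((C.b₂ + 3 * C.b₄ * w + 3 * C.b₆ * w ^ 2 + C.b₈ * w ^ 3) * w) := by
    have : t = w⁻¹ := by simp [hw]
    rw [this] at ht t0
    have w0 : w ≠ 0 := by simpa using t0
    field_simp at ht
    linear_combination ht
  have : ‖(3 : K)‖ < 1 := by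
    rw [e, norm_neg]
    refine norm_mul_lt_left ?_ hw1
    have hw2 := norm_pow_le_one hw1.le 2
    have hw3 := norm_pow_le_one hw1.le 3
    exact nonarch_add_le (nonarch_add_le (nonarch_add_le h.b₂
      (norm_mul_le_left (norm_mul_le_left h3.le h.b₄) hw1.le))
      (norm_mul_le_left (norm_mul_le_left h3.le h.b₆) hw2)) (norm_mul_le_left h.b₈ hw3)
  linarith

/-- The `y`-coordinate of a point with integral `x`-coordinate is integral. -/
theorem norm_y_le_one {ξ η : K} (hξ : ‖ξ‖ ≤ 1)
    (he : η ^ 2 + (C.a₁ * ξ + C.a₃) * η = ξ ^ 3 + C.a₂ * ξ ^ 2 + C.a₄ * ξ + C.a₆) :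
    ‖η‖ ≤ 1 := by
  by_contra! hc
  have h1 : ‖C.a₁ * ξ + C.a₃‖ ≤ 1 := nonarch_add_le (norm_mul_le_left h.a₁ hξ) h.a₃
  have h2 : ‖ξ ^ 3 + C.a₂ * ξ ^ 2 + C.a₄ * ξ + C.a₆‖ ≤ 1 :=
    nonarch_add_le (nonarch_add_le (nonarch_add_le (norm_pow_le_one hξ 3)
      (norm_mul_le_left h.a₂ (norm_pow_le_one hξ 2))) (norm_mul_le_left h.a₄ hξ)) h.a₆
  have h3 : ‖(η + (C.a₁ * ξ + C.a₃)) * η‖ ≤ 1 := by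
    rw [show (η + (C.a₁ * ξ + C.a₃)) * η = η ^ 2 + (C.a₁ * ξ + C.a₃) * η by ring, he]
    exact h2
  rw [norm_mul, nonarch_add_eq (h1.trans_lt hc)] at h3
  nlinarith

end IntegralCoeffs

/-- The numerator of the duplication formula `x(2 P) = duplNum (x(P)) / duplDen (x(P))`. -/
def duplNum (C : WeierstrassCurve K) (ξ : K) : K :=
  ξ ^ 4 - C.b₄ * ξ ^ 2 - 2 * C.b₆ * ξ - C.b₈

/-- The denominator of the duplication formula `x(2 P) = duplNum (x(P)) / duplDen (x(P))`. -/
def duplDen (C : WeierstrassCurve K) (ξ : K) : K :=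
  4 * ξ ^ 3 + C.b₂ * ξ ^ 2 + 2 * C.b₄ * ξ + C.b₆

/-- The points with `x`-coordinate `ξ` reduce to nonsingular points: either they reduce to the point
at infinity, or the numerator and the denominator of the duplication formula do not both vanish in
the residue field. -/
def NonsingularReduction (C : WeierstrassCurve K) (ξ : K) : Prop :=
  1 < ‖ξ‖ ∨ (‖ξ‖ ≤ 1 ∧ (¬ ‖C.duplDen ξ‖ < 1 ∨ ¬ ‖C.duplNum ξ‖ < 1))

/-- If the discriminant is a unit, then every point reduces to a nonsingular one. -/
theorem nonsingularReduction_of_norm_Δ {C : WeierstrassCurve K} (h : C.IntegralCoeffs)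
    (hΔ : ‖C.Δ‖ = 1) (ξ : K) : C.NonsingularReduction ξ := by
  refine (lt_or_ge 1 ‖ξ‖).imp_right fun hξ => ⟨hξ, ?_⟩
  by_contra! hc
  -- the discriminant as a combination of `duplDen ξ` and `duplNum ξ`
  have e : C.Δ =
      (12 * ξ ^ 3 - C.b₂ * ξ ^ 2 - 10 * C.b₄ * ξ + C.b₂ * C.b₄ - 27 * C.b₆) * C.duplDen ξ -
        (48 * ξ ^ 2 + 8 * C.b₂ * ξ + 32 * C.b₄ - C.b₂ ^ 2) * C.duplNum ξ := by
    have := C.b_relation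
    rw [duplNum, duplDen, Δ]
    linear_combination (-(8 * C.b₄ + 12 * ξ ^ 2 + 2 * C.b₂ * ξ)) * this
  have hξ2 := norm_pow_le_one hξ 2
  have : ‖C.Δ‖ < 1 := by
    rw [e]
    refine nonarch_sub_lt (norm_mul_lt_left ?_ hc.1) (norm_mul_lt_left ?_ hc.2)
    rotate_left
    · exact nonarch_sub_le (nonarch_add_le (nonarch_add_le
        (norm_mul_le_left (norm_ofNat_le_one 48) hξ2)
        (norm_mul_le_left (norm_mul_le_left (norm_ofNat_le_one 8) h.b₂) hξ))
        (norm_mul_le_left (norm_ofNat_le_one 32) h.b₄)) (norm_pow_le_one h.b₂ 2)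
    · exact nonarch_sub_le (nonarch_add_le (nonarch_sub_le (nonarch_sub_le
        (norm_mul_le_left (norm_ofNat_le_one 12) (norm_pow_le_one hξ 3))
        (norm_mul_le_left h.b₂ hξ2))
        (norm_mul_le_left (norm_mul_le_left (norm_ofNat_le_one 10) h.b₄) hξ))
        (norm_mul_le_left h.b₂ h.b₄)) (norm_mul_le_left (norm_ofNat_le_one 27) h.b₆)
  linarith

variable [DecidableEq K] {C : WeierstrassCurve K}

/-- Reduction is injective on `3`-torsion if `3` is a unit, in the following form: two points of
nonsingular reduction which have the same reduction and differ by `3`-torsion are equal. The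
points are on the quadratic twist of `C` by `e ^ 2`; the reduction is that of `C`, with coordinates
`ξ`, `η`. -/
theorem eq_of_reduction_eq (h : C.IntegralCoeffs) (h3 : ‖(3 : K)‖ = 1) (h2 : (2 : K) ≠ 0)
    {e : K} (he : e ≠ 0) {x y ξ η x' y' ξ' η' : K}
    {hP : (C.quadTwist (e ^ 2)).toAffine.Nonsingular x y}
    {hP' : (C.quadTwist (e ^ 2)).toAffine.Nonsingular x' y'}
    (hξ : x = e ^ 2 * ξ) (hη : 2 * y = e ^ 3 * (2 * η + C.a₁ * ξ + C.a₃))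
    (hξ' : x' = e ^ 2 * ξ') (hη' : 2 * y' = e ^ 3 * (2 * η' + C.a₁ * ξ' + C.a₃))
    (hns : C.NonsingularReduction ξ)
    (hξξ' : ‖ξ‖ = ‖ξ'‖) (hcξ : ‖ξ‖ ≤ 1 → ‖ξ - ξ'‖ < 1) (hcη : ‖η‖ ≤ 1 → ‖η - η'‖ < 1)
    (ht : (3 : ℕ) • (Affine.Point.some x y hP - Affine.Point.some x' y' hP') = 0) :
    Affine.Point.some x y hP = Affine.Point.some x' y' hP' := by
  by_contra hne
  have hd : e ^ 2 ≠ 0 := pow_ne_zero 2 he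
  have hsub := sub_ne_zero.mpr hne
  have htor := three_torsion_twistX hd h2 hsub ht
  have ht1 := h.norm_le_one_of_three_torsion h3 htor
  have hdiff := sq_sub_mul_twistX_sub h2 he hξ hη hξ' hη' hne
  have hquad := twistX_add_root hd h2 (Affine.Point.some_ne_zero hP)
    (neg_ne_zero.mpr (Affine.Point.some_ne_zero hP')) (by rwa [← sub_eq_add_neg])
  rw [← sub_eq_add_neg, twistX_neg] at hquad
  have hxξ : twistX C (e ^ 2) (Affine.Point.some x y hP) = ξ := by
    rw [twistX, xCoord, hξ, mul_div_cancel_left₀ _ hd]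
  have hxξ' : twistX C (e ^ 2) (Affine.Point.some x' y' hP') = ξ' := by
    rw [twistX, xCoord, hξ', mul_div_cancel_left₀ _ hd]
  rw [hxξ, hxξ'] at hquad
  have n2 := norm_ofNat_le_one (K := K) 2
  have n4 := norm_ofNat_le_one (K := K) 4
  generalize twistX C (e ^ 2) (_ - _) = t at *
  rcases hns with hbig | ⟨hle, hns⟩
  · -- both points reduce to the point at infinity
    obtain ⟨u, hu⟩ : ∃ u, u = ξ⁻¹ := ⟨_, rfl⟩
    obtain ⟨v, hv⟩ : ∃ v, v = ξ'⁻¹ := ⟨_, rfl⟩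
    have hu1 : ‖u‖ < 1 := by rw [hu, norm_inv]; exact inv_lt_one_of_one_lt₀ hbig
    have hv1 : ‖v‖ < 1 := by rw [hv, norm_inv]; exact inv_lt_one_of_one_lt₀ (hξξ' ▸ hbig)
    have key : (1 : K) = ((2 + C.b₄ * (u * v)) * (u + v) + (C.b₂ * u + C.b₆ * u ^ 2 * v) * v -
        (v - u) * t * (v - u)) * t +
        (C.b₄ * u + C.b₆ * (u + v) * u + C.b₈ * u ^ 2 * v) * v := by
      have e1 : ξ = u⁻¹ := by simp [hu]
      have e2 : ξ' = v⁻¹ := by simp [hv]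
      have u0 : u ≠ 0 := by
        rw [hu]; exact inv_ne_zero (norm_pos_iff.mp (by linarith))
      have v0 : v ≠ 0 := by
        rw [hv]; exact inv_ne_zero (norm_pos_iff.mp (by linarith))
      rw [e1, e2] at hquad
      field_simp at hquad
      linear_combination hquad
    have hu2 := norm_pow_le_one hu1.le 2
    have huv := nonarch_add_lt hu1 hv1
    have hvu := nonarch_sub_lt hv1 hu1
    have : ‖(1 : K)‖ < 1 := by
      rw [key]
      refine nonarch_add_lt ?_ (norm_mul_lt_left ?_ hv1)
      · rw [mul_comm]
        refine norm_mul_lt_left ht1 (nonarch_sub_lt (nonarch_add_lt (norm_mul_lt_left ?_ huv)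
          (norm_mul_lt_left ?_ hv1)) (norm_mul_lt_left (norm_mul_le_left hvu.le ht1) hvu))
        · exact nonarch_add_le n2 (norm_mul_le_left h.b₄ (norm_mul_le_left hu1.le hv1.le))
        · exact nonarch_add_le (norm_mul_le_left h.b₂ hu1.le)
            (norm_mul_le_left (norm_mul_le_left h.b₆ hu2) hv1.le)
      · exact nonarch_add_le (nonarch_add_le (norm_mul_le_left h.b₄ hu1.le)
          (norm_mul_le_left (norm_mul_le_left h.b₆ huv.le) hu1.le))
          (norm_mul_le_left (norm_mul_le_left h.b₈ hu2) hv1.le)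
    simp at this
  · have hle' : ‖ξ'‖ ≤ 1 := hξξ' ▸ hle
    have hδ := hcξ hle
    have heq := equation_of_quadTwist h2 he hP hξ hη
    have heq' := equation_of_quadTwist h2 he hP' hξ' hη'
    have hη1 := h.norm_y_le_one hle heq
    have hη1' := h.norm_y_le_one hle' heq'
    have hε := hcη hη1
    -- the line through the first point and the negative of the second one
    set N := η + η' + C.a₁ * ξ' + C.a₃ with hN
    have hN1 : ‖N‖ ≤ 1 := nonarch_add_le (nonarch_add_le (nonarch_add_le hη1 hη1')
      (norm_mul_le_left h.a₁ hle')) h.a₃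
    have hNlt : ‖N‖ < 1 := by
      have e1 : N * N = ((ξ - ξ') * t - C.a₁ * N + (C.a₂ + ξ + ξ') * (ξ - ξ')) * (ξ - ξ') := by
        linear_combination -hdiff
      have : ‖N * N‖ < 1 := by
        rw [e1]
        refine norm_mul_lt_left ?_ hδ
        exact nonarch_add_le (nonarch_sub_le (norm_mul_le_left hδ.le ht1)
          (norm_mul_le_left h.a₁ hN1)) (norm_mul_le_left
            (nonarch_add_le (nonarch_add_le h.a₂ hle) hle') hδ.le)
      rw [norm_mul] at this
      by_contra! hc
      nlinarith
    have hψ : ‖2 * η + C.a₁ * ξ + C.a₃‖ < 1 := by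
      rw [show 2 * η + C.a₁ * ξ + C.a₃ = N + ((η - η') + C.a₁ * (ξ - ξ')) by rw [hN]; ring]
      exact nonarch_add_lt hNlt (nonarch_add_lt hε (norm_mul_lt_left h.a₁ hδ))
    have hden : C.duplDen ξ = (2 * η + C.a₁ * ξ + C.a₃) * (2 * η + C.a₁ * ξ + C.a₃) := by
      rw [duplDen, WeierstrassCurve.b₂, WeierstrassCurve.b₄, WeierstrassCurve.b₆]
      linear_combination -4 * heq
    have hden1 : ‖C.duplDen ξ‖ < 1 := by
      rw [hden]; exact norm_mul_lt_left hψ.le hψ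
    refine hns.elim (fun hh => hh hden1) (fun hh => hh ?_)
    -- modulo the maximal ideal, the quadratic equation for `t` becomes `duplNum ξ = duplDen ξ * t`
    have e2 : C.duplNum ξ = t * C.duplDen ξ + ((ξ ^ 2 * (ξ + ξ') - C.b₄ * ξ - C.b₆) -
        (2 * ξ * (2 * ξ + ξ') + C.b₂ * ξ + C.b₄) * t - (ξ - ξ') * t ^ 2) * (ξ - ξ') := by
      rw [duplNum, duplDen]
      linear_combination hquad
    rw [e2]
    refine nonarch_add_lt (norm_mul_lt_left ht1 hden1) (norm_mul_lt_left ?_ hδ)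
    refine nonarch_sub_le (nonarch_sub_le (nonarch_sub_le (nonarch_sub_le ?_ ?_) h.b₆)
      (norm_mul_le_left ?_ ht1)) (norm_mul_le_left hδ.le (norm_pow_le_one ht1 2))
    · exact norm_mul_le_left (norm_pow_le_one hle 2) (nonarch_add_le hle hle')
    · exact norm_mul_le_left h.b₄ hle
    · exact nonarch_add_le (nonarch_add_le (norm_mul_le_left (norm_mul_le_left n2 hle)
        (nonarch_add_le (norm_mul_le_left n2 hle) hle')) (norm_mul_le_left h.b₂ hle)) h.b₄

end Separation

end WeierstrassCurve

namespace WeierstrassCurve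

section Node

/-! ### The node of a multiplicative reduction -/

section Padic

variable {p : ℕ} [Fact p.Prime]

theorem norm_int_eq_one_iff (k : ℤ) : ‖(k : ℤ_[p])‖ = 1 ↔ ¬ (p : ℤ) ∣ k := by
  rw [← PadicInt.norm_int_lt_one_iff_dvd, not_lt]
  exact ⟨fun h => h.ge, fun h => le_antisymm (PadicInt.norm_le_one _) h⟩

theorem valuation_lt_one_iff_norm (k : ℤ) :
    (IsDiscreteValuationRing.maximalIdeal ℤ_[p]).valuation ℚ_[p] (k : ℚ_[p]) < 1 ↔
      (p : ℤ) ∣ k := by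
  have h : (IsDiscreteValuationRing.maximalIdeal ℤ_[p]).valuation ℚ_[p]
      (algebraMap ℤ_[p] ℚ_[p] k) < 1 ↔ _ :=
    IsDedekindDomain.HeightOneSpectrum.valuation_lt_one_iff_mem _ (k : ℤ_[p])
  have hk : algebraMap ℤ_[p] ℚ_[p] (k : ℤ_[p]) = (k : ℚ_[p]) := map_intCast _ k
  rw [hk] at h
  rw [h, ← PadicInt.norm_int_lt_one_iff_dvd, ← PadicInt.mem_nonunits]
  rfl

variable {E : WeierstrassCurve ℤ}

theorem baseChange_padic_Δ : (E.baseChange ℚ_[p]).Δ = (E.Δ : ℚ_[p]) := by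
  rw [baseChange, map_Δ, eq_intCast]

theorem baseChange_padic_c₄ : (E.baseChange ℚ_[p]).c₄ = (E.c₄ : ℚ_[p]) := by
  rw [baseChange, map_c₄, eq_intCast]

theorem GoodAt.not_dvd_Δ (h : E.GoodAt p) : ¬ (p : ℤ) ∣ E.Δ := by
  have := HasGoodReduction.goodReduction (R := ℤ_[p]) (W := E.baseChange ℚ_[p]) (self := h)
  rw [baseChange_padic_Δ] at this
  rw [← valuation_lt_one_iff_norm, this]
  exact lt_irrefl _

theorem MultiplicativeAt.dvd_Δ (h : E.MultiplicativeAt p) : (p : ℤ) ∣ E.Δ := by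
  have := HasMultiplicativeReduction.badReduction (R := ℤ_[p]) (W := E.baseChange ℚ_[p])
    (self := h)
  rwa [baseChange_padic_Δ, valuation_lt_one_iff_norm] at this

theorem MultiplicativeAt.not_dvd_c₄ (h : E.MultiplicativeAt p) : ¬ (p : ℤ) ∣ E.c₄ := by
  have := HasMultiplicativeReduction.multiplicativeReduction (R := ℤ_[p])
    (W := E.baseChange ℚ_[p]) (self := h)
  rw [baseChange_padic_c₄] at this
  rw [← valuation_lt_one_iff_norm, this]
  exact lt_irrefl _

/-- The translation `x = X + r` that turns an equation with multiplicative reduction at `p` into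
one of the form `(2 y) ^ 2 = 4 X ^ 3 + s X ^ 2 + 4 β`, with `s = b₂ + 12 r` a unit and `β` of the
same absolute value as the discriminant. -/
theorem exists_node (A : WeierstrassCurve ℤ_[p]) (hc₄ : ‖A.c₄‖ = 1) (hΔ : ‖A.Δ‖ < 1) :
    ∃ r β : ℤ_[p], 6 * r ^ 2 + A.b₂ * r + A.b₄ = 0 ∧ ‖A.b₂ + 12 * r‖ = 1 ∧
      A.b₈ + 3 * r * A.b₆ + 3 * r ^ 2 * A.b₄ + r ^ 3 * A.b₂ + 3 * r ^ 4 = (A.b₂ + 12 * r) * β ∧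
      ‖β‖ = ‖A.Δ‖ := by
  obtain ⟨u, hu⟩ := (PadicInt.isUnit_iff.mpr hc₄).exists_right_inv
  have hu1 : ‖u‖ = 1 := by
    have := congrArg norm hu
    rwa [norm_mul, hc₄, one_mul, norm_one] at this
  have hrel := A.c_relation
  have hbrel := A.b_relation
  have hc₆ : ‖A.c₆‖ = 1 := by
    have h1 : ‖A.c₆ ^ 2‖ = 1 := by
      rw [show A.c₆ ^ 2 = A.c₄ ^ 3 + -(1728 * A.Δ) by linear_combination hrel,
        nonarch_add_eq] <;> rw [norm_pow, hc₄, one_pow]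
      rw [norm_neg, norm_mul]
      exact (mul_le_of_le_one_left (norm_nonneg _) (PadicInt.norm_le_one _)).trans_lt hΔ
    rw [norm_pow] at h1
    exact (pow_eq_one_iff_of_nonneg (norm_nonneg _) two_ne_zero).mp h1
  -- the `x`-coordinate of the node of the reduction
  set a := (18 * A.b₆ - A.b₂ * A.b₄) * u with ha
  let F : Polynomial ℤ_[p] := 6 * .X ^ 2 + .C A.b₂ * .X + .C A.b₄
  have hF : ∀ z : ℤ_[p], F.aeval z = 6 * z ^ 2 + A.b₂ * z + A.b₄ := fun z => by simp [F]
  have hF' : ∀ z : ℤ_[p], F.derivative.aeval z = A.b₂ + 12 * z := fun z => by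
    simp [F]; ring
  have hFa : 6 * a ^ 2 + A.b₂ * a + A.b₄ = -72 * u ^ 2 * A.Δ := by
    have e : 6 * a ^ 2 + A.b₂ * a + A.b₄ = u ^ 2 * (6 * (18 * A.b₆ - A.b₂ * A.b₄) ^ 2 +
        A.b₂ * (18 * A.b₆ - A.b₂ * A.b₄) * A.c₄ + A.b₄ * A.c₄ ^ 2) := by
      rw [ha]
      linear_combination (-(A.b₂ * (18 * A.b₆ - A.b₂ * A.b₄) * u) - A.b₄ * (A.c₄ * u + 1)) * hu
    rw [e, c₄, Δ]
    linear_combination -18 * u ^ 2 * A.b₂ ^ 2 * hbrel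
  have hFa' : A.b₂ + 12 * a = -A.c₆ * u := by
    rw [ha, c₆]
    have : A.b₂ = A.b₂ * (A.c₄ * u) := by rw [hu, mul_one]
    rw [c₄] at this
    linear_combination this
  have hn' : ‖A.b₂ + 12 * a‖ = 1 := by
    rw [hFa', norm_mul, norm_neg, hc₆, hu1, one_mul]
  obtain ⟨r, hr, hra, hr', -⟩ := hensels_lemma (F := F) (a := a) (by
    rw [hF, hF', hFa, hn', one_pow, norm_mul]
    exact (mul_le_of_le_one_left (norm_nonneg _) (PadicInt.norm_le_one _)).trans_lt hΔ)
  rw [hF] at hr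
  rw [hF', hF', hn'] at hr'
  rw [hF', hn'] at hra
  obtain ⟨v, hv⟩ := (PadicInt.isUnit_iff.mpr hr').exists_right_inv
  set s := A.b₂ + 12 * r with hs
  set β := (A.b₈ + 3 * r * A.b₆ + 3 * r ^ 2 * A.b₄ + r ^ 3 * A.b₂ + 3 * r ^ 4) * v with hβ
  have h8 : A.b₈ + 3 * r * A.b₆ + 3 * r ^ 2 * A.b₄ + r ^ 3 * A.b₂ + 3 * r ^ 4 = s * β := by
    rw [hβ]
    linear_combination -(A.b₈ + 3 * r * A.b₆ + 3 * r ^ 2 * A.b₄ + r ^ 3 * A.b₂ + 3 * r ^ 4) * hv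
  have s0 : s ≠ 0 := fun h => by rw [h, norm_zero] at hr'; exact zero_ne_one hr'
  have h6 : A.b₆ + 2 * r * A.b₄ + r ^ 2 * A.b₂ + 4 * r ^ 3 = 4 * β := by
    apply mul_left_cancel₀ s0
    rw [hs] at h8 ⊢
    linear_combination 4 * h8 - hbrel + (6 * r ^ 2 + A.b₂ * r + A.b₄) * hr
  have hc₄s : A.c₄ = s ^ 2 := by
    rw [c₄, hs]; linear_combination -24 * hr
  have hb₂ : A.b₂ = s - 12 * r := by rw [hs]; ring
  have hb₄ : A.b₄ = 6 * r ^ 2 - s * r := by linear_combination hr - r * hb₂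
  have hb₆ : A.b₆ = 4 * β - 4 * r ^ 3 + s * r ^ 2 := by
    linear_combination h6 - 2 * r * hb₄ - r ^ 2 * hb₂
  have hb₈ : A.b₈ = s * β - 12 * r * β + 3 * r ^ 4 - s * r ^ 3 := by
    linear_combination h8 - 3 * r * hb₆ - 3 * r ^ 2 * hb₄ - r ^ 3 * hb₂
  have hΔβ : A.Δ = -(β * (s ^ 3 + 432 * β)) := by
    rw [Δ, hb₈, hb₆, hb₄, hb₂]; ring
  have hc₆β : A.c₆ = -(s ^ 3 + 864 * β) := by
    rw [c₆, hb₆, hb₄, hb₂]; ring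
  refine ⟨r, β, hr, hr', h8, ?_⟩
  have h432 : ‖432 * β‖ < 1 := by
    by_cases hp2 : p = 2
    · subst hp2
      rw [norm_mul]
      refine (mul_le_of_le_one_right (norm_nonneg _) (PadicInt.norm_le_one _)).trans_lt ?_
      have := (PadicInt.norm_int_lt_one_iff_dvd (p := 2) 432).mpr (by norm_num)
      exact_mod_cast this
    · -- `β` is small because `r` is congruent to the approximate root `a`
      have h864 : 864 * β = 12 * A.c₄ * (a - r) := by
        linear_combination hc₆β + s * hc₄s - A.c₄ * hFa' + A.c₆ * hu - A.c₄ * hs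
      have hn : ‖(2 : ℤ_[p])‖ = 1 := by
        have := (norm_int_eq_one_iff (p := p) 2).mpr (by
          intro h
          have h2 : p ∣ 2 := by exact_mod_cast h
          exact hp2 ((Nat.prime_dvd_prime_iff_eq Fact.out Nat.prime_two).mp h2))
        exact_mod_cast this
      rw [show ‖432 * β‖ = ‖864 * β‖ by
        rw [show 864 * β = 2 * (432 * β) by ring, norm_mul 2 (432 * β), hn, one_mul], h864,
        norm_mul, norm_sub_rev]
      exact (mul_le_of_le_one_left (norm_nonneg _) (PadicInt.norm_le_one _)).trans_lt hra
  have hone : ‖s ^ 3 + 432 * β‖ = 1 := by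
    have : ‖s ^ 3‖ = 1 := by rw [norm_pow, hr', one_pow]
    rw [nonarch_add_eq (by rwa [this]), this]
  rw [hΔβ, norm_neg, norm_mul β, hone, mul_one]

end Padic

/-- Over an ultrametric field, the translated coordinate `X = ξ - r` on the twist of a curve of
multiplicative reduction. -/
theorem nodalCoordinate {K : Type*} [NormedField K] [DecidableEq K] (C : WeierstrassCurve K)
    {d r β : K} (hd : d ≠ 0) (h2 : (2 : K) ≠ 0) (hr : 6 * r ^ 2 + C.b₂ * r + C.b₄ = 0)
    (hs : ‖C.b₂ + 12 * r‖ = 1)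
    (hβ : C.b₈ + 3 * r * C.b₆ + 3 * r ^ 2 * C.b₄ + r ^ 3 * C.b₂ + 3 * r ^ 4 = (C.b₂ + 12 * r) * β)
    (hβ1 : ‖β‖ < 1) :
    NodalCoordinate (fun P => twistX C d P - r) (C.b₂ + 12 * r) β := by
  have s0 : C.b₂ + 12 * r ≠ 0 := norm_pos_iff.mp (by rw [hs]; exact one_pos)
  have h6 : C.b₆ + 2 * r * C.b₄ + r ^ 2 * C.b₂ + 4 * r ^ 3 = 4 * β := by
    apply mul_left_cancel₀ s0
    linear_combination 4 * hβ - C.b_relation + (6 * r ^ 2 + C.b₂ * r + C.b₄) * hr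
  refine ⟨hs, hβ1, fun P => by simp only [twistX_neg],
    fun hP hQ h => eq_or_eq_neg_of_twistX_eq hd hP hQ (sub_left_injective h),
    fun {P Q} hP hQ hPQ => ?_, fun {P Q} hP hQ hPQ hPQ' => ?_⟩
  · have := twistX_add_root hd h2 hP hQ hPQ
    generalize twistX C d (P + Q) = t at *
    generalize twistX C d P = x at *
    generalize twistX C d Q = y at *
    have hb₄ : C.b₄ = -(6 * r ^ 2 + C.b₂ * r) := by linear_combination hr
    have hb₆ : C.b₆ = 4 * β + 8 * r ^ 3 + C.b₂ * r ^ 2 := by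
      linear_combination h6 - 2 * r * hb₄
    have hb₈ : C.b₈ = C.b₂ * β - 9 * r ^ 4 - C.b₂ * r ^ 3 := by
      linear_combination hβ - 3 * r * hb₆ - 3 * r ^ 2 * hb₄
    rw [hb₄, hb₆, hb₈] at this
    linear_combination this
  · have := twistX_add_add_sub hd h2 hP hQ hPQ hPQ'
    generalize twistX C d (P + Q) = t at *
    generalize twistX C d (P - Q) = t' at *
    generalize twistX C d P = x at *
    generalize twistX C d Q = y at *
    linear_combination this + ((x - r) + (y - r)) * hr + h6

end Node

end WeierstrassCurve

namespace WeierstrassCurve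

open Affine.Point (xCoord)
open scoped Classical

section TorsionPoint

/-! ### Points of order three at a node -/

variable {K : Type*} [NormedField K]

theorem exists_root_norm_lt_one {f : Polynomial K} (hf : f.Splits)
    (h : ‖f.coeff 0‖ < ‖f.leadingCoeff‖) : ∃ t, f.IsRoot t ∧ ‖t‖ < 1 := by
  by_contra! hc
  have h0 : f ≠ 0 := by
    rintro rfl
    simp at h
  have hprod : ∀ m : Multiset K, (∀ t ∈ m, 1 ≤ ‖t‖) → 1 ≤ ‖m.prod‖ := by
    intro m
    induction m using Multiset.induction with
    | empty => simp
    | cons a m ih =>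
      intro hm
      rw [Multiset.prod_cons, norm_mul]
      exact one_le_mul_of_one_le_of_one_le (hm a (Multiset.mem_cons_self a m))
        (ih fun t ht => hm t (Multiset.mem_cons_of_mem ht))
  have h1 := hprod f.roots fun t ht => hc t ((Polynomial.mem_roots h0).mp ht)
  rw [hf.coeff_zero_eq_leadingCoeff_mul_prod_roots, norm_mul, norm_mul, norm_pow, norm_neg,
    norm_one, one_pow, one_mul] at h
  nlinarith [norm_nonneg f.leadingCoeff]

variable [IsUltrametricDist K] [IsAlgClosed K] {C : WeierstrassCurve K} {d r β : K}

/-- A multiplicative reduction has a point of order `3` outside of the identity component. Its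
`X`-coordinate is a root of the third division polynomial `3 X ^ 4 + s X ^ 3 + 12 β X + s β`. -/
theorem exists_three_torsion (hd : d ≠ 0) (h2 : (2 : K) ≠ 0) (h3 : ‖(3 : K)‖ = 1)
    (hr : 6 * r ^ 2 + C.b₂ * r + C.b₄ = 0) (hs : ‖C.b₂ + 12 * r‖ = 1)
    (hβ : C.b₈ + 3 * r * C.b₆ + 3 * r ^ 2 * C.b₄ + r ^ 3 * C.b₂ + 3 * r ^ 4 = (C.b₂ + 12 * r) * β)
    (hβ1 : ‖β‖ < 1) (hβ0 : β ≠ 0) :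
    ∃ T : (C.quadTwist d).toAffine.Point, T ≠ 0 ∧ (3 : ℕ) • T = 0 ∧
      ‖twistX C d T - r‖ ^ 3 = ‖β‖ := by
  obtain ⟨s, hs'⟩ : ∃ s, s = C.b₂ + 12 * r := ⟨_, rfl⟩
  rw [← hs'] at hs hβ
  have s0 : s ≠ 0 := norm_pos_iff.mp (by rw [hs]; exact one_pos)
  have hb₂ : C.b₂ = s - 12 * r := by rw [hs']; ring
  have hb₄ : C.b₄ = 6 * r ^ 2 - s * r := by linear_combination hr - r * hb₂
  have h6 : C.b₆ + 2 * r * C.b₄ + r ^ 2 * C.b₂ + 4 * r ^ 3 = 4 * β := by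
    apply mul_left_cancel₀ s0
    rw [hs']
    rw [hs'] at hβ
    linear_combination 4 * hβ - C.b_relation + (6 * r ^ 2 + C.b₂ * r + C.b₄) * hr
  have hb₆ : C.b₆ = 4 * β - 4 * r ^ 3 + s * r ^ 2 := by
    linear_combination h6 - 2 * r * hb₄ - r ^ 2 * hb₂
  have hb₈ : C.b₈ = s * β - 12 * r * β + 3 * r ^ 4 - s * r ^ 3 := by
    linear_combination hβ - 3 * r * hb₆ - 3 * r ^ 2 * hb₄ - r ^ 3 * hb₂
  have h30 : (3 : K) ≠ 0 := norm_pos_iff.mp (by rw [h3]; exact one_pos)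
  obtain ⟨t, ht, ht1⟩ : ∃ t : K, 3 * t ^ 4 + s * t ^ 3 + 12 * β * t + s * β = 0 ∧ ‖t‖ < 1 := by
    let f : Polynomial K := .C 3 * .X ^ 4 + .C s * .X ^ 3 + .C (12 * β) * .X + .C (s * β)
    have hdeg : f.natDegree = 4 := by
      simp only [f]; compute_degree!
    obtain ⟨t, ht, ht1⟩ := exists_root_norm_lt_one (f := f) (IsAlgClosed.splits f) (by
      have e1 : f.coeff 0 = s * β := by simp [f]
      have e2 : f.leadingCoeff = 3 := by
        rw [Polynomial.leadingCoeff, hdeg]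
        simp [f]
      rwa [e1, e2, h3, norm_mul, hs, one_mul])
    refine ⟨t, ?_, ht1⟩
    simpa [f, Polynomial.IsRoot] using ht
  have n12 := norm_ofNat_le_one (K := K) 12
  have n4 := norm_ofNat_le_one (K := K) 4
  have u1 : ‖s + 3 * t‖ = 1 := by
    rw [nonarch_add_eq, hs]
    rw [hs]; exact norm_mul_lt_left h3.le ht1
  have u2 : ‖s + 12 * t‖ = 1 := by
    rw [nonarch_add_eq, hs]
    rw [hs]; exact norm_mul_lt_left n12 ht1
  have ht3 : ‖t‖ ^ 3 = ‖β‖ := by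
    have : (s + 3 * t) * t ^ 3 = -((s + 12 * t) * β) := by linear_combination ht
    have := congrArg norm this
    rwa [norm_mul, u1, one_mul, norm_neg, norm_mul, u2, one_mul, norm_pow] at this
  have t0 : 0 < ‖t‖ := by
    by_contra hc
    rw [le_antisymm (not_lt.mp hc) (norm_nonneg _)] at ht3
    norm_num at ht3
    exact hβ0 (norm_eq_zero.mp ht3.symm)
  have hψ : t ^ 2 * (s + 4 * t) + 4 * β ≠ 0 := by
    have u4 : ‖t ^ 2 * (s + 4 * t)‖ = ‖t‖ ^ 2 := by
      rw [norm_mul, norm_pow, nonarch_add_eq, hs, mul_one]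
      rw [hs]; exact norm_mul_lt_left n4 ht1
    have hlt : ‖t‖ ^ 3 < ‖t‖ ^ 2 := pow_lt_pow_right_of_lt_one₀ t0 ht1 (by norm_num)
    refine norm_pos_iff.mp ?_
    rw [nonarch_add_eq, u4]
    · positivity
    · rw [u4]; exact norm_mul_lt_left n4 (ht3 ▸ hlt)
  have h4 : (4 : K) ≠ 0 := by rw [show (4 : K) = 2 * 2 by norm_num]; exact mul_ne_zero h2 h2
  -- the point with this `X`-coordinate
  set x := d * (t + r) with hx
  set V := C.quadTwist d with hV
  obtain ⟨y, hy⟩ := IsAlgClosed.exists_pow_nat_eq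
    (x ^ 3 + V.a₂ * x ^ 2 + V.a₄ * x + V.a₆) (n := 2) two_pos
  have hS : 4 * x ^ 3 + V.b₂ * x ^ 2 + 2 * V.b₄ * x + V.b₆ =
      d ^ 3 * (t ^ 2 * (s + 4 * t) + 4 * β) := by
    rw [hV, quadTwist_b₂ C d h2, quadTwist_b₄ C d h2, quadTwist_b₆ C d h2, hb₂, hb₄, hb₆, hx]
    ring
  have hy4 : 4 * y ^ 2 = d ^ 3 * (t ^ 2 * (s + 4 * t) + 4 * β) := by
    rw [← hS, hy, b₂, b₄, b₆, show V.a₁ = 0 from rfl, show V.a₃ = 0 from rfl]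
    ring
  have hS0 : d ^ 3 * (t ^ 2 * (s + 4 * t) + 4 * β) ≠ 0 := mul_ne_zero (pow_ne_zero 3 hd) hψ
  have hyy : y ≠ V.toAffine.negY x y := by
    intro h
    simp only [Affine.negY, show V.a₁ = 0 from rfl, show V.a₃ = 0 from rfl] at h
    have h2y : 2 * y = 0 := by linear_combination h
    apply hS0
    rw [← hy4]
    linear_combination 2 * y * h2y
  have hns : V.toAffine.Nonsingular x y := by
    rw [Affine.nonsingular_iff]
    refine ⟨(Affine.equation_iff _ _).mpr ?_, Or.inr ?_⟩
    · rw [show V.toAffine.a₁ = 0 from rfl, show V.toAffine.a₃ = 0 from rfl]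
      linear_combination hy
    · exact hyy
  have hxT : xCoord (Affine.Point.some x y hns) = x := rfl
  refine ⟨.some x y hns, Affine.Point.some_ne_zero hns, ?_, ?_⟩
  · refine three_nsmul_eq_zero rfl rfl ?_ ?_ ?_
    · rw [Affine.Point.add_self_of_Y_ne hyy]
      exact Affine.Point.some_ne_zero _
    · rw [hxT, quadTwist_b₂ C d h2, quadTwist_b₄ C d h2, quadTwist_b₆ C d h2,
        quadTwist_b₈ C d h2, hb₂, hb₄, hb₆, hb₈, hx]
      linear_combination d ^ 4 * ht
    · rw [hxT, hS]
      exact hS0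
  · rw [twistX, hxT, hx, mul_div_cancel_left₀ _ hd, add_sub_cancel_right, ht3]

end TorsionPoint

section LocalField

/-! ### Reduction over the algebraic closure of `ℚ_[p]` -/

variable {p : ℕ} [Fact p.Prime]

theorem padicAlgCl_norm_intCast (k : ℤ) : ‖(k : PadicAlgCl p)‖ = ‖(k : ℤ_[p])‖ := by
  have h : ‖algebraMap ℚ_[p] (PadicAlgCl p) k‖ = _ := PadicAlgCl.norm_extends p (k : ℚ_[p])
  rw [map_intCast] at h
  rw [h, ← PadicInt.padic_norm_e_of_padicInt, PadicInt.coe_intCast]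

theorem padicAlgCl_norm_intCast_eq_one_iff (k : ℤ) :
    ‖(k : PadicAlgCl p)‖ = 1 ↔ ¬ (p : ℤ) ∣ k := by
  rw [padicAlgCl_norm_intCast, norm_int_eq_one_iff]

theorem padicAlgCl_norm_intCast_le_one (k : ℤ) : ‖(k : PadicAlgCl p)‖ ≤ 1 := by
  rw [padicAlgCl_norm_intCast]
  exact PadicInt.norm_le_one _

theorem padicAlgCl_norm_three (hp : p ≠ 3) : ‖(3 : PadicAlgCl p)‖ = 1 := by
  have := (padicAlgCl_norm_intCast_eq_one_iff (p := p) 3).mpr (fun h => hp (by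
    have h3 : p ∣ 3 := by exact_mod_cast h
    exact (Nat.prime_dvd_prime_iff_eq Fact.out Nat.prime_three).mp h3))
  exact_mod_cast this

theorem integralCoeffs_map (E : WeierstrassCurve ℤ) :
    (E.map (Int.castRingHom (PadicAlgCl p))).IntegralCoeffs := by
  constructor <;> exact padicAlgCl_norm_intCast_le_one _

/-- At a prime `p ≠ 3` of multiplicative reduction with `3 ∤ ordₚ(Δ)`, let `P` be a point over the
algebraic closure of `ℚ_[p]` such that `3 • P` is rational. Then some multiple of `P`, prime to `3`,
has nonsingular reduction after translation by a point of order dividing `3`. -/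
theorem exists_nsmul_add_nonsingularReduction (hp : p ≠ 3) {E : WeierstrassCurve ℤ} (hE : E.Δ ≠ 0)
    (hm : E.MultiplicativeAt p) (hord : ¬ 3 ∣ padicValInt p E.Δ) {d : ℤ} (hd : d ≠ 0)
    {D : PadicAlgCl p} (hD : D = d)
    {C : WeierstrassCurve (PadicAlgCl p)} (hC : C = E.map (Int.castRingHom (PadicAlgCl p)))
    (P : (C.quadTwist D).toAffine.Point)
    (hP : ∀ j : ℕ, ∃ q : ℚ_[p], xCoord (j • (3 : ℕ) • P) = algebraMap _ _ q) :
    ∃ (m : ℕ) (T : (C.quadTwist D).toAffine.Point), ¬ 3 ∣ m ∧ (3 : ℕ) • T = 0 ∧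
      (m • P + T = 0 ∨ C.NonsingularReduction (twistX C D (m • P + T))) := by
  set A := E.map (Int.castRingHom ℤ_[p]) with hA
  have hAΔ : A.Δ = (E.Δ : ℤ_[p]) := by rw [hA, map_Δ]; rfl
  obtain ⟨r, β, hr, hs, hβ, hβΔ⟩ := exists_node A
    (by rw [hA, map_c₄]; exact (norm_int_eq_one_iff _).mpr hm.not_dvd_c₄)
    (by rw [hAΔ]; exact (PadicInt.norm_int_lt_one_iff_dvd _).mpr hm.dvd_Δ)
  let φ : ℤ_[p] →+* PadicAlgCl p := (algebraMap ℚ_[p] (PadicAlgCl p)).comp PadicInt.Coe.ringHom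
  have hφn : ∀ z, ‖φ z‖ = ‖z‖ := fun z => PadicAlgCl.norm_extends p z
  have hCA : C = A.map φ := by
    rw [hC, hA, map_map]
    congr 1
  have hΔ1 : ‖β‖ < 1 := by
    rw [hβΔ, hAΔ]; exact (PadicInt.norm_int_lt_one_iff_dvd _).mpr hm.dvd_Δ
  have hr' : 6 * φ r ^ 2 + C.b₂ * φ r + C.b₄ = 0 := by
    have := congrArg φ hr
    simpa [hCA, map_ofNat φ, map_b₂, map_b₄] using this
  have hs' : ‖C.b₂ + 12 * φ r‖ = 1 := by
    rw [← hs, ← hφn]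
    simp [hCA, map_ofNat φ, map_b₂]
  have hβ' : C.b₈ + 3 * φ r * C.b₆ + 3 * φ r ^ 2 * C.b₄ + φ r ^ 3 * C.b₂ + 3 * φ r ^ 4 =
      (C.b₂ + 12 * φ r) * φ β := by
    have := congrArg φ hβ
    simpa [hCA, map_ofNat φ, map_b₂, map_b₄, map_b₆, map_b₈] using this
  have hβ1 : ‖φ β‖ < 1 := by rwa [hφn]
  have hp0 : (0 : ℝ) < p := by exact_mod_cast (Fact.out : p.Prime).pos
  have hp1 : (1 : ℝ) < p := by exact_mod_cast (Fact.out : p.Prime).one_lt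
  have hβn : ‖φ β‖ = ((p : ℝ)⁻¹) ^ padicValInt p E.Δ := by
    rw [hφn, hβΔ, hAΔ, ← PadicInt.padic_norm_e_of_padicInt, PadicInt.coe_intCast]
    have h1 := Padic.norm_eq_zpow_neg_valuation (p := p) (x := (E.Δ : ℚ_[p]))
      (by exact_mod_cast hE)
    rw [h1, Padic.valuation_intCast, zpow_neg, zpow_natCast, inv_pow]
  have hβ0 : φ β ≠ 0 := norm_pos_iff.mp (hβn ▸ pow_pos (inv_pos.mpr hp0) _)
  have hD0 : D ≠ 0 := by rw [hD]; exact_mod_cast hd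
  have h3 := padicAlgCl_norm_three hp
  have h2 : (2 : PadicAlgCl p) ≠ 0 := two_ne_zero
  have hnode := nodalCoordinate C hD0 h2 hr' hs' hβ' hβ1
  obtain ⟨T, T0, hT, hT3⟩ := exists_three_torsion (C := C) hD0 h2 h3 hr' hs' hβ' hβ1 hβ0
  obtain ⟨m, T', hm3, hT', hns⟩ := hnode.exists_nsmul_add_isNonsing (inv_pos.mpr hp0)
    (inv_lt_one_of_one_lt₀ hp1) hord hβn hT T0 hT3 P (by
      intro j hj
      obtain ⟨q, hq⟩ := hP j
      have e : twistX C D (j • (3 : ℕ) • P) - φ r = algebraMap ℚ_[p] (PadicAlgCl p) (q / d - r) := by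
        rw [twistX, hq, hD]
        simp only [map_sub, map_div₀, map_intCast]
        rfl
      change twistX C D (j • (3 : ℕ) • P) - φ r ≠ 0 at hj
      change ∃ k : ℤ, ‖twistX C D (j • (3 : ℕ) • P) - φ r‖ = _
      rw [e] at hj ⊢
      have hq0 : q / d - r ≠ 0 := fun h => hj (by rw [h, map_zero])
      refine ⟨(q / d - r).valuation, ?_⟩
      rw [show ‖algebraMap ℚ_[p] (PadicAlgCl p) (q / d - r)‖ = ‖q / d - (r : ℚ_[p])‖ from
        PadicAlgCl.norm_extends p _, Padic.norm_eq_zpow_neg_valuation hq0, inv_zpow, zpow_neg])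
  refine ⟨m, T', hm3, hT', hns.imp_right fun hX => ?_⟩
  -- the point does not reduce to the node
  change 1 ≤ ‖twistX C D (m • P + T') - φ r‖ at hX
  generalize twistX C D (m • P + T') = ξ at hX
  refine (lt_or_ge 1 ‖ξ‖).imp_right fun hξ => ⟨hξ, ?_⟩
  by_contra! hc
  have hr1 : ‖φ r‖ ≤ 1 := by rw [hφn]; exact PadicInt.norm_le_one _
  have hX1 : ‖ξ - φ r‖ = 1 := le_antisymm (nonarch_sub_le hξ hr1) hX
  have e : (ξ - φ r) ^ 4 = C.duplNum ξ - φ r * C.duplDen ξ +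
      (8 * (ξ - φ r) + (C.b₂ + 12 * φ r)) * φ β := by
    have h6 : C.b₆ + 2 * φ r * C.b₄ + φ r ^ 2 * C.b₂ + 4 * φ r ^ 3 = 4 * φ β := by
      have s0 : C.b₂ + 12 * φ r ≠ 0 := norm_pos_iff.mp (by rw [hs']; exact one_pos)
      apply mul_left_cancel₀ s0
      linear_combination 4 * hβ' - C.b_relation + (6 * φ r ^ 2 + C.b₂ * φ r + C.b₄) * hr'
    rw [duplNum, duplDen]
    linear_combination hβ' + 2 * (ξ - φ r) * h6 + (ξ - φ r) ^ 2 * hr'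
  have : ‖(ξ - φ r) ^ 4‖ < 1 := by
    rw [e]
    refine nonarch_add_lt (nonarch_sub_lt hc.2 (norm_mul_lt_left hr1 hc.1))
      (norm_mul_lt_left (nonarch_add_le (norm_mul_le_left (norm_ofNat_le_one 8) hX1.le) hs'.le) hβ1)
  rw [norm_pow, hX1, one_pow] at this
  exact this.false

/-- The point `P'` is the conjugate of `P` by `σ`. -/
def IsConj {K : Type*} [Field K] {V : WeierstrassCurve K} (σ : K → K) :
    V.toAffine.Point → V.toAffine.Point → Prop
  | .zero, .zero => True
  | .some x y _, .some x' y' _ => x' = σ x ∧ y' = σ y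
  | _, _ => False

/-- A point of nonsingular reduction that is congruent to its conjugate under an element of the
inertia group modulo `3`-torsion is fixed by that element. -/
theorem eq_of_mem_padicInertia (hp : p ≠ 3) {C : WeierstrassCurve (PadicAlgCl p)}
    {E : WeierstrassCurve ℤ} (hC : C = E.map (Int.castRingHom (PadicAlgCl p)))
    {e : PadicAlgCl p} (he : e ≠ 0) {σ : PadicAlgCl p ≃ₐ[ℚ_[p]] PadicAlgCl p}
    (hσ : σ ∈ padicInertia p) (hσe : σ e = e) {R R' : (C.quadTwist (e ^ 2)).toAffine.Point}
    (hRR' : IsConj σ R R') (hR : R = 0 ∨ C.NonsingularReduction (twistX C (e ^ 2) R))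
    (h3 : (3 : ℕ) • (R - R') = 0) : R = R' := by
  rcases R with _ | ⟨x, y, h⟩ <;> rcases R' with _ | ⟨x', y', h'⟩
  · rfl
  · exact hRR'.elim
  · exact hRR'.elim
  obtain ⟨hx, hy⟩ := hRR'
  have he2 : e ^ 2 ≠ 0 := pow_ne_zero 2 he
  have he3 : e ^ 3 ≠ 0 := pow_ne_zero 3 he
  have hns := hR.resolve_left (Affine.Point.some_ne_zero h)
  obtain ⟨ξ, hξ⟩ : ∃ ξ, ξ = x / e ^ 2 := ⟨_, rfl⟩
  obtain ⟨η, hη⟩ : ∃ η, η = (2 * y / e ^ 3 - C.a₁ * ξ - C.a₃) / 2 := ⟨_, rfl⟩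
  have hσn : ∀ z, ‖σ z‖ = ‖z‖ := fun z => (spectralNorm_eq_of_equiv (K := ℚ_[p]) σ z).symm
  have ha : ∀ k : ℤ, σ (k : PadicAlgCl p) = k := fun k => map_intCast σ k
  have hxξ : x = e ^ 2 * ξ := by rw [hξ, mul_div_cancel₀ _ he2]
  have hyη : 2 * y = e ^ 3 * (2 * η + C.a₁ * ξ + C.a₃) := by
    rw [hη]; field_simp; ring
  have hxξ' : x' = e ^ 2 * σ ξ := by rw [hx, hxξ, map_mul, map_pow, hσe]
  have hyη' : 2 * y' = e ^ 3 * (2 * σ η + C.a₁ * σ ξ + C.a₃) := by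
    have e1 : σ C.a₁ = C.a₁ := by rw [hC]; exact ha _
    have e3 : σ C.a₃ = C.a₃ := by rw [hC]; exact ha _
    have := congrArg σ hyη
    simp only [map_mul, map_add, map_pow, hσe, e1, e3, map_ofNat] at this
    rw [hy, this]
  have hcl : ∀ z, ‖z‖ ≤ 1 → ‖z - σ z‖ < 1 := fun z hz => by
    rw [norm_sub_rev]; exact hσ z hz
  exact eq_of_reduction_eq (hC ▸ integralCoeffs_map E) (padicAlgCl_norm_three hp) two_ne_zero he
    hxξ hyη hxξ' hyη' (hξ ▸ hns) (hσn ξ).symm (hcl ξ) (hcl η) h3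

end LocalField

end WeierstrassCurve

section Cocycles

/-! ### Cocycles that restrict to coboundaries -/

section

variable {G M H : Type*} [Group G] [TopologicalSpace G] [AddCommGroup M] [DistribMulAction G M]
  [Group H]

theorem exists_contH1Mk_eq (c : contH1 G M) : ∃ f, contH1Mk G M f = c :=
  QuotientAddGroup.mk'_surjective _ c

theorem contH1Map_mk_eq_zero_iff {N : Type*} [TopologicalSpace H] [AddCommGroup N]
    [DistribMulAction H N] (φ : H →* G) (hφ : Continuous φ) (ψ : M →+ N)
    (hψ : ∀ h m, ψ (φ h • m) = h • ψ m) (f : contZ1 G M) :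
    contH1Map φ hφ ψ hψ (contH1Mk G M f) = 0 ↔ ∃ n : N, ∀ h, ψ (f.1 (φ h)) = h • n - n :=
  QuotientAddGroup.eq_zero_iff (N := contB1 H N) (contZ1Map φ hφ ψ hψ f)

theorem contH1Res_mk_eq_zero_iff (I : Subgroup G) (f : contZ1 G M) :
    contH1Res I (contH1Mk G M f) = 0 ↔ ∃ m : M, ∀ g ∈ I, f.1 g = g • m - m :=
  (contH1Map_mk_eq_zero_iff _ _ _ _ _).trans
    ⟨fun ⟨m, hm⟩ => ⟨m, fun g hg => hm ⟨g, hg⟩⟩, fun ⟨m, hm⟩ => ⟨m, fun g => hm g.1 g.2⟩⟩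

/-- A cocycle with values in a module killed by `3`, which vanishes on a subgroup of index at most
`2`, is a coboundary. -/
theorem exists_coboundary_of_index_two (h3 : ∀ m : M, (3 : ℕ) • m = 0) (f : contZ1 G M)
    (φ : H →* G) (I J : Subgroup H) (hIJ : ∀ h ∈ I, h ∈ J → f.1 (φ h) = 0)
    (hJ : ∀ a ∈ I, ∀ b ∈ I, a ∉ J → b ∉ J → a * b ∈ J) :
    ∃ m : M, ∀ h ∈ I, f.1 (φ h) = φ h • m - m := by
  by_cases hle : I ≤ J
  · exact ⟨0, fun h hh => by rw [hIJ h hh (hle hh), smul_zero, sub_zero]⟩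
  obtain ⟨a, haI, haJ⟩ := SetLike.not_le_iff_exists.mp hle
  have hf := f.2.2
  -- the cocycle is constant outside of `J`
  have hconst : ∀ b ∈ I, b ∉ J → f.1 (φ b) = f.1 (φ a) := by
    intro b hbI hbJ
    have hab : f.1 (φ (a⁻¹ * b)) = 0 := hIJ _ (I.mul_mem (I.inv_mem haI) hbI)
      (hJ _ (I.inv_mem haI) _ hbI (fun h => haJ (by simpa using h)) hbJ)
    have := hf (φ a) (φ (a⁻¹ * b))
    rwa [← map_mul, mul_inv_cancel_left, hab, smul_zero, add_zero] at this
  refine ⟨f.1 (φ a), fun h hh => ?_⟩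
  by_cases hhJ : h ∈ J
  · have h1 := hf (φ h) (φ a)
    rw [← map_mul, hconst (h * a) (I.mul_mem hh haI)
      (fun hc => haJ ((J.mul_mem_cancel_left hhJ).mp hc)), hIJ h hh hhJ, zero_add] at h1
    rw [hIJ h hh hhJ, ← h1, sub_self]
  · have h1 := hf (φ h) (φ a)
    rw [← map_mul, hIJ _ (I.mul_mem hh haI) (hJ h hh a haI hhJ haJ), hconst h hh hhJ] at h1
    rw [hconst h hh hhJ, eq_sub_iff_add_eq, ← sub_eq_zero,
      show f.1 (φ a) + f.1 (φ a) - φ h • f.1 (φ a) =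
        (3 : ℕ) • f.1 (φ a) - (f.1 (φ a) + φ h • f.1 (φ a)) by abel, h3, ← h1, sub_zero]

end

section

variable {A : Type*} [AddCommGroup A] {s : A →+ A} {P T : A}

theorem nsmul_eq_of_nsmul_sub_eq_zero {n : ℕ} {Q : A} (h : n • (Q - P) = 0) : n • Q = n • P := by
  rwa [smul_sub, sub_eq_zero] at h

theorem three_nsmul_neg_nsmul (hT : (3 : ℕ) • T = 0) (m : ℕ) : (3 : ℕ) • -(m • T) = 0 := by
  rw [smul_neg, smul_comm, hT, smul_zero, neg_zero]

theorem three_nsmul_sub_eq_zero (hT : (3 : ℕ) • T = 0) (hP : (3 : ℕ) • (s P - P) = 0) (m : ℕ) :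
    (3 : ℕ) • (m • P + T - s (m • P + T)) = 0 := by
  have h := nsmul_eq_of_nsmul_sub_eq_zero hP
  rw [smul_sub, ← map_nsmul, smul_add, hT, add_zero, smul_comm, map_nsmul, map_nsmul, h, sub_self]

/-- If `s P - P` has order dividing `3` and `m • P + T` is fixed by `s`, where `m` is prime to `3`,
then `s P - P` is the value of the coboundary of `-(m • T)`. -/
theorem sub_eq_of_nsmul_add_eq {m : ℕ} (hm : ¬ 3 ∣ m)
    (hP : (3 : ℕ) • (s P - P) = 0) (hs : s (m • P + T) = m • P + T) :
    s P - P = s (-(m • T)) - -(m • T) := by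
  have hu : m • (s P - P) = -(s T - T) := by
    rw [map_add, map_nsmul] at hs
    rw [smul_sub, ← sub_eq_zero, ← sub_eq_zero.mpr hs]
    abel
  -- `m ^ 2 ≡ 1` modulo `3`
  obtain ⟨k, hk⟩ : ∃ k, m * m = 1 + 3 * k := by
    have : m % 3 = 1 ∨ m % 3 = 2 := by omega
    have h1 : m * m % 3 = 1 := by rcases this with h | h <;> simp [Nat.mul_mod, h]
    exact ⟨m * m / 3, by omega⟩
  calc s P - P = (1 + 3 * k) • (s P - P) := by
        rw [add_smul, one_smul, mul_smul, smul_comm, hP, smul_zero, add_zero]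
    _ = m • -(s T - T) := by rw [← hk, mul_smul, hu]
    _ = s (-(m • T)) - -(m • T) := by
        rw [map_neg, map_nsmul, smul_neg, smul_sub]; abel

end

end Cocycles

namespace WeierstrassCurve

open Affine.Point (xCoord)
open scoped Classical

section LocalStatements

/-! ### Triviality of local cocycles on the inertia group -/

variable {p : ℕ} [Fact p.Prime]

/-- The inertia group acts trivially on a square root of an integer `d ≡ 1` modulo `4` that is prime
to `p`. -/
theorem padicInertia_apply_sqrt {d : ℤ} (hd4 : d ≡ 1 [ZMOD 4]) (hpd : ¬ (p : ℤ) ∣ d)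
    {e : PadicAlgCl p} (he : e ^ 2 = d) {σ : PadicAlgCl p ≃ₐ[ℚ_[p]] PadicAlgCl p}
    (hσ : σ ∈ padicInertia p) : σ e = e := by
  have hse : (σ e) ^ 2 = e ^ 2 := by rw [← map_pow, he, map_intCast]
  refine (sq_eq_sq_iff_eq_or_eq_neg.mp hse).resolve_right fun hneg => ?_
  have he1 : ‖e‖ = 1 := by
    have h1 : ‖e ^ 2‖ = 1 := by rw [he]; exact (padicAlgCl_norm_intCast_eq_one_iff d).mpr hpd
    rw [norm_pow] at h1
    exact (pow_eq_one_iff_of_nonneg (norm_nonneg _) two_ne_zero).mp h1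
  -- the integral generator `(1 + √d) / 2` also works at `p = 2`
  obtain ⟨k, hk⟩ := hd4.symm.dvd
  obtain ⟨z, hz⟩ : ∃ z, z = (1 + e) / 2 := ⟨_, rfl⟩
  have hzk : z * (z - 1) = (k : PadicAlgCl p) := by
    have : (d : PadicAlgCl p) - 1 = 4 * k := by exact_mod_cast congrArg (Int.cast) hk
    rw [hz]
    field_simp
    linear_combination he + this
  have hz1 : ‖z‖ ≤ 1 := by
    by_contra! hc
    have h1 : ‖z * (z - 1)‖ ≤ 1 := by rw [hzk]; exact padicAlgCl_norm_intCast_le_one k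
    rw [norm_mul, sub_eq_add_neg, nonarch_add_eq (by simpa using hc)] at h1
    nlinarith
  have h2 := hσ z hz1
  have hsz : σ z - z = -e := by
    rw [hz, map_div₀, map_add, hneg, map_one, map_ofNat]; ring
  rw [hsz, norm_neg, he1] at h2
  exact h2.false

/-- At a prime of good reduction, the part of the inertia group that fixes `√d` acts trivially on
the points of the twist by `d` which it fixes modulo `3`-torsion. -/
theorem eq_of_not_dvd_Δ (hp : p ≠ 3) {E : WeierstrassCurve ℤ}
    {C : WeierstrassCurve (PadicAlgCl p)} (hC : C = E.map (Int.castRingHom (PadicAlgCl p)))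
    {e : PadicAlgCl p} (he : e ≠ 0) {V : WeierstrassCurve (PadicAlgCl p)}
    (hV : V = C.quadTwist (e ^ 2)) (hΔ : ¬ (p : ℤ) ∣ E.Δ) {σ : PadicAlgCl p ≃ₐ[ℚ_[p]] PadicAlgCl p}
    (hσ : σ ∈ padicInertia p) (hσe : σ e = e) {P P' : V.toAffine.Point} (hPP' : IsConj σ P P')
    (h3 : (3 : ℕ) • (P' - P) = 0) : P' = P := by
  subst hV
  refine (eq_of_mem_padicInertia hp hC he hσ hσe hPP' (.inr ?_) ?_).symm
  · refine nonsingularReduction_of_norm_Δ (hC ▸ integralCoeffs_map E) ?_ _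
    rw [hC, map_Δ]
    exact (padicAlgCl_norm_intCast_eq_one_iff _).mpr hΔ
  · rw [show (3 : ℕ) • (P - P') = -((3 : ℕ) • (P' - P)) by abel, h3, neg_zero]

/-- At a prime of multiplicative reduction, the cocycle `σ ↦ σ P - P` with values in the `3`-torsion
is a coboundary of a `3`-torsion point on the inertia group. -/
theorem exists_torsion_of_multiplicativeAt (hp : p ≠ 3) {E : WeierstrassCurve ℤ}
    {C : WeierstrassCurve (PadicAlgCl p)} (hC : C = E.map (Int.castRingHom (PadicAlgCl p)))
    {e : PadicAlgCl p} (he : e ≠ 0) {V : WeierstrassCurve (PadicAlgCl p)}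
    (hV : V = C.quadTwist (e ^ 2)) (hE : E.Δ ≠ 0) (hm : E.MultiplicativeAt p)
    (hord : ¬ 3 ∣ padicValInt p E.Δ) {d : ℤ} (hd4 : d ≡ 1 [ZMOD 4]) (hpd : ¬ (p : ℤ) ∣ d)
    (hed : e ^ 2 = d)
    (act : (PadicAlgCl p ≃ₐ[ℚ_[p]] PadicAlgCl p) → V.toAffine.Point →+ V.toAffine.Point)
    (hact : ∀ (σ : PadicAlgCl p ≃ₐ[ℚ_[p]] PadicAlgCl p) (Q : V.toAffine.Point),
      IsConj σ Q (act σ Q)) (P : V.toAffine.Point)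
    (hP : ∀ σ, (3 : ℕ) • (act σ P - P) = 0) :
    ∃ T : V.toAffine.Point, (3 : ℕ) • T = 0 ∧
      ∀ σ ∈ padicInertia p, act σ P - P = act σ T - T := by
  subst hV
  have hd0 : d ≠ 0 := by rintro rfl; exact hpd (dvd_zero _)
  obtain ⟨m, T, hm3, hT, hR⟩ := exists_nsmul_add_nonsingularReduction hp hE hm hord hd0 hed hC P
    (by
      intro j
      suffices h : ∀ σ : PadicAlgCl p ≃ₐ[ℚ_[p]] PadicAlgCl p,
          σ (xCoord (j • (3 : ℕ) • P)) = xCoord (j • (3 : ℕ) • P) from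
        ((InfiniteGalois.mem_range_algebraMap_iff_fixed _).mpr h).imp fun q hq => hq.symm
      intro σ
      have hfix : act σ (j • (3 : ℕ) • P) = j • (3 : ℕ) • P := by
        rw [map_nsmul, map_nsmul, nsmul_eq_of_nsmul_sub_eq_zero (hP σ)]
      have hc := hact σ (j • (3 : ℕ) • P)
      rw [hfix] at hc
      generalize j • (3 : ℕ) • P = Q at hc
      rcases Q with _ | ⟨x, y, h⟩
      · exact map_zero σ
      · exact hc.1.symm)
  refine ⟨-(m • T), three_nsmul_neg_nsmul hT m, fun σ hσ => ?_⟩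
  refine sub_eq_of_nsmul_add_eq hm3 (hP σ) ?_
  exact (eq_of_mem_padicInertia hp hC he hσ (padicInertia_apply_sqrt hd4 hpd hed hσ)
    (hact σ (m • P + T)) hR (three_nsmul_sub_eq_zero hT (hP σ) m)).symm

end LocalStatements

section Descent

/-! ### Algebraicity of torsion points -/

variable {F : Type*} [Field F] [Algebra ℚ F] (ι : AlgebraicClosure ℚ →ₐ[ℚ] F)

theorem exists_eq_of_isIntegral {x : F} (hx : _root_.IsIntegral ℚ x) : ∃ x₀, ι x₀ = x := by
  have hs : ((minpoly ℚ x).map (algebraMap ℚ (AlgebraicClosure ℚ))).Splits :=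
    IsAlgClosed.splits _
  refine hs.mem_range_of_isRoot (i := ι.toRingHom) ?_ ?_
  · exact (Polynomial.map_ne_zero_iff (algebraMap ℚ _).injective).mpr (minpoly.ne_zero hx)
  · rw [Polynomial.map_map, Polynomial.IsRoot, Polynomial.eval_map]
    have : ι.toRingHom.comp (algebraMap ℚ (AlgebraicClosure ℚ)) = algebraMap ℚ F :=
      ι.comp_algebraMap
    rw [this]
    exact minpoly.aeval ℚ x

/-- The points of order `3` are algebraic over `ℚ`. -/
theorem exists_map_eq_of_three_nsmul_eq_zero {W : WeierstrassCurve ℚ} (h₁ : W.a₁ = 0)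
    (h₃ : W.a₃ = 0) (T : (W.baseChange F).toAffine.Point) (hT : (3 : ℕ) • T = 0) :
    ∃ T₀ : (W.baseChange (AlgebraicClosure ℚ)).toAffine.Point,
      Affine.Point.map (W' := W.toAffine) ι T₀ = T := by
  have h₁' : (W.baseChange F).a₁ = 0 := by simp [baseChange, h₁]
  have h₃' : (W.baseChange F).a₃ = 0 := by simp [baseChange, h₃]
  by_cases hT0 : T = 0
  · exact ⟨0, by rw [map_zero, hT0]⟩
  have hψ := three_torsion_xCoord h₁' h₃' hT0 hT
  rcases T with _ | ⟨x, y, h⟩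
  · exact absurd rfl hT0
  have heq := equation_of_nonsingular h₁' h₃' h
  simp only [xCoord, baseChange, map_b₂, map_b₄, map_b₆, map_b₈] at hψ
  simp only [baseChange, map_a₂, map_a₄, map_a₆] at heq
  have hx : _root_.IsIntegral ℚ x := by
    rw [← isAlgebraic_iff_isIntegral]
    let f : Polynomial ℚ := .C 3 * .X ^ 4 + .C W.b₂ * .X ^ 3 + .C (3 * W.b₄) * .X ^ 2 +
      .C (3 * W.b₆) * .X + .C W.b₈
    have hdeg : f.natDegree = 4 := by
      simp only [f]; compute_degree!
    refine ⟨f, fun h0 => by rw [h0] at hdeg; simp at hdeg, ?_⟩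
    simpa [f] using hψ
  have hy : _root_.IsIntegral ℚ y := by
    refine _root_.IsIntegral.of_pow two_pos ?_
    rw [heq]
    exact (((hx.pow 3).add (isIntegral_algebraMap.mul (hx.pow 2))).add
      (isIntegral_algebraMap.mul hx)).add isIntegral_algebraMap
  obtain ⟨x₀, rfl⟩ := exists_eq_of_isIntegral ι hx
  obtain ⟨y₀, rfl⟩ := exists_eq_of_isIntegral ι hy
  exact ⟨.some x₀ y₀ ((W.toAffine.baseChange_nonsingular ι.injective ..).mp h), rfl⟩

end Descent

end WeierstrassCurve

section Selmer

/-! ### Selmer classes on inertia groups -/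

open scoped WeierstrassCurve.Affine Classical
open WeierstrassCurve

theorem three_nsmul_torsionModule {W : WeierstrassCurve ℚ} (m : torsionModule W 3) :
    (3 : ℕ) • m = 0 :=
  Subtype.ext (AddSubgroup.torsionBy.nsmul_iff.mp m.2)

/-- Classes of order `3` are trivial on the decomposition group of order `2` at infinity. -/
theorem contH1Res_range_complex_eq_zero (W : WeierstrassCurve ℚ) (f : contZ1 GalQ (torsionModule W 3))
    (ι : AlgebraicClosure ℚ →ₐ[ℚ] ℂ) :
    contH1Res (galoisRestriction ℝ ι).range (contH1Mk _ _ f) = 0 := by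
  rw [contH1Res_mk_eq_zero_iff]
  have hf1 : f.1 1 = 0 := by simpa using f.2.2 1 1
  have hconj : ∀ σ : ℂ ≃ₐ[ℝ] ℂ, σ ≠ 1 → σ = Complex.conjAe := by
    intro σ hσ
    rcases Complex.real_algHom_eq_id_or_conj σ.toAlgHom with h | h
    · exact absurd (AlgEquiv.ext fun z => DFunLike.congr_fun h z) hσ
    · exact AlgEquiv.ext fun z => DFunLike.congr_fun h z
  obtain ⟨m, hm⟩ := exists_coboundary_of_index_two three_nsmul_torsionModule f
    (galoisRestriction ℝ ι) ⊤ ⊥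
    (fun h _ hh => by rw [Subgroup.mem_bot.mp hh, map_one, hf1]) (by
      intro a _ b _ ha hb
      rw [hconj a ha, hconj b hb, Subgroup.mem_bot]
      exact AlgEquiv.ext fun z => Complex.conj_conj z)
  refine ⟨m, ?_⟩
  rintro _ ⟨σ, rfl⟩
  exact hm σ trivial

theorem contH1Res_padicInertia_eq_zero {p : ℕ} [Fact p.Prime] (hp : p ≠ 3) {E : WeierstrassCurve ℤ}
    (hE : E.Δ ≠ 0) (hss : E.GoodAt p ∨ E.MultiplicativeAt p)
    (hord : ¬ E.GoodAt p → ¬ 3 ∣ padicValInt p E.Δ) {d : ℤ} (hd4 : d ≡ 1 [ZMOD 4])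
    (hcop : IsCoprime d E.Δ)
    (f : contZ1 GalQ (torsionModule ((E.baseChange ℚ).quadTwist (d : ℚ)) 3))
    (ι : AlgebraicClosure ℚ →ₐ[ℚ] PadicAlgCl p)
    (hf : torsionLocalization ((E.baseChange ℚ).quadTwist (d : ℚ)) 3 ℚ_[p] ι (contH1Mk _ _ f) = 0) :
    contH1Res ((padicInertia p).map (galoisRestriction ℚ_[p] ι)) (contH1Mk _ _ f) = 0 := by
  have hd0 : (d : PadicAlgCl p) ≠ 0 := by
    rw [Int.cast_ne_zero]
    rintro rfl
    exact absurd hd4 (by decide)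
  obtain ⟨e, hed⟩ := IsAlgClosed.exists_pow_nat_eq (d : PadicAlgCl p) two_pos
  have he : e ≠ 0 := by
    rintro rfl
    exact hd0 (by rw [← hed]; simp)
  have hV : ((E.baseChange ℚ).quadTwist (d : ℚ)).baseChange (PadicAlgCl p) =
      (E.map (Int.castRingHom (PadicAlgCl p))).quadTwist (e ^ 2) := by
    rw [baseChange, map_quadTwist, baseChange, map_map, hed, map_intCast]
    congr 2
  generalize hW : (E.baseChange ℚ).quadTwist (d : ℚ) = W at *
  obtain ⟨P, hP⟩ := (contH1Map_mk_eq_zero_iff _ _ _ _ f).mp hf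
  let μ := Affine.Point.map (W' := W.toAffine) ι
  have hμ : Function.Injective μ := Affine.Point.map_injective ι
  have hμσ : ∀ (σ : PadicAlgCl p ≃ₐ[ℚ_[p]] PadicAlgCl p)
      (Q : (W.baseChange (AlgebraicClosure ℚ)).toAffine.Point),
      μ (galoisRestriction ℚ_[p] ι σ • Q) = σ • μ Q := by
    intro σ Q
    rcases Q with _ | ⟨x, y, h⟩
    · rfl
    · change Affine.Point.some _ _ _ = Affine.Point.some _ _ _
      congr 1 <;> exact galoisRestriction_spec ι σ _
  replace hP : ∀ σ : PadicAlgCl p ≃ₐ[ℚ_[p]] PadicAlgCl p,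
      μ (f.1 (galoisRestriction ℚ_[p] ι σ)).1 = σ • P - P := hP
  have h3 : ∀ σ : PadicAlgCl p ≃ₐ[ℚ_[p]] PadicAlgCl p, (3 : ℕ) • (σ • P - P) = 0 := by
    intro σ
    rw [← hP, ← map_nsmul, AddSubgroup.torsionBy.nsmul_iff.mp (f.1 _).2, map_zero]
  have hact : ∀ (σ : PadicAlgCl p ≃ₐ[ℚ_[p]] PadicAlgCl p)
      (Q : (W.baseChange (PadicAlgCl p)).toAffine.Point), IsConj σ Q (σ • Q) := by
    intro σ Q
    rcases Q with _ | ⟨x, y, h⟩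
    · trivial
    · exact ⟨rfl, rfl⟩
  suffices h : ∃ m : torsionModule W 3, ∀ σ ∈ padicInertia p,
      f.1 (galoisRestriction ℚ_[p] ι σ) = galoisRestriction ℚ_[p] ι σ • m - m by
    obtain ⟨m, hm⟩ := h
    refine (contH1Res_mk_eq_zero_iff _ f).mpr ⟨m, ?_⟩
    rintro _ ⟨σ, hσ, rfl⟩
    exact hm σ hσ
  by_cases hΔ : (p : ℤ) ∣ E.Δ
  · have hbad : ¬ E.GoodAt p := fun hg => hg.not_dvd_Δ hΔ
    have hpd : ¬ (p : ℤ) ∣ d := fun h =>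
      (Nat.prime_iff_prime_int.mp (Fact.out : p.Prime)).not_isUnit (hcop.isUnit_of_dvd' h hΔ)
    obtain ⟨T, hT, hPT⟩ := exists_torsion_of_multiplicativeAt hp rfl he hV hE (hss.resolve_left hbad)
      (hord hbad) hd4 hpd hed (fun σ => DistribSMul.toAddMonoidHom _ σ) hact P h3
    obtain ⟨T₀, rfl⟩ := exists_map_eq_of_three_nsmul_eq_zero ι (by rw [← hW]; rfl)
      (by rw [← hW]; rfl) T hT
    have hT₀ : (3 : ℕ) • T₀ = 0 := hμ (by rw [map_nsmul, map_zero]; exact hT)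
    refine ⟨⟨T₀, AddSubgroup.torsionBy.nsmul_iff.mpr hT₀⟩, fun σ hσ => Subtype.ext (hμ ?_)⟩
    rw [hP]
    refine (hPT σ hσ).trans ?_
    change σ • μ T₀ - μ T₀ = μ (galoisRestriction ℚ_[p] ι σ • T₀ - T₀)
    rw [map_sub, hμσ]
  · refine exists_coboundary_of_index_two three_nsmul_torsionModule f (galoisRestriction ℚ_[p] ι)
      (padicInertia p) (MulAction.stabilizer _ e) (fun σ hσ hσe => Subtype.ext (hμ ?_)) ?_
    · rw [hP]
      refine (sub_eq_zero.mpr ?_).trans (map_zero μ).symm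
      exact eq_of_not_dvd_Δ hp rfl he hV hΔ hσ hσe (hact σ P) (h3 σ)
    · have hneg : ∀ σ : PadicAlgCl p ≃ₐ[ℚ_[p]] PadicAlgCl p,
          σ ∉ MulAction.stabilizer _ e → σ e = -e := by
        intro σ hσ
        have hse : (σ e) ^ 2 = e ^ 2 := by rw [← map_pow, hed, map_intCast]
        exact (sq_eq_sq_iff_eq_or_eq_neg.mp hse).resolve_left hσ
      intro σ _ τ _ hσ hτ
      change σ (τ e) = e
      rw [hneg τ hτ, map_neg, hneg σ hσ, neg_neg]

end Selmer

/-- `E` is an elliptic curve over `ℚ`, given by a global minimal Weierstrass equation. -/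
theorem proposition2p5 (E : WeierstrassCurve ℤ) (hE : E.Δ ≠ 0)
    (hmin : ∀ (p : ℕ) [Fact p.Prime], E.MinimalAt p)
    -- `E` is semistable
    (hss : ∀ (p : ℕ) [Fact p.Prime], E.GoodAt p ∨ E.MultiplicativeAt p)
    -- `ord₂(Δ)` is odd, `3` is a prime of good reduction, `3 ∤ ordₚ(Δ)` at the bad primes
    (h2 : Odd (padicValInt 2 E.Δ))
    (h3 : E.GoodAt 3)
    (hord : ∀ (p : ℕ) [Fact p.Prime], ¬ E.GoodAt p → ¬ 3 ∣ padicValInt p E.Δ)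
    (d : ℤ) (hd : Squarefree d) (hd4 : d ≡ 1 [ZMOD 4]) (hcop : IsCoprime d E.Δ)
    -- the choice of `d` at the primes of split multiplicative reduction
    (hs2 : E.SplitAt 2 → ¬ d ≡ 1 [ZMOD 8])
    (hs : ∀ (p : ℕ) [Fact p.Prime], p ≠ 2 → E.SplitAt p →
      (p ≡ 1 [MOD 3] → ¬ IsSquare (d : ZMod p)) ∧ (p ≡ 2 [MOD 3] → IsSquare (d : ZMod p)))
    -- the choice of `d` at the primes of nonsplit multiplicative reduction
    (hn2 : E.NonsplitAt 2 → d ≡ 1 [ZMOD 8])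
    (hn : ∀ (p : ℕ) [Fact p.Prime], p ≠ 2 → E.NonsplitAt p →
      (p ≡ 1 [MOD 3] → IsSquare (d : ZMod p)) ∧ (p ≡ 2 [MOD 3] → ¬ IsSquare (d : ZMod p))) :
    selmerGroup ((E.baseChange ℚ).quadTwist (d : ℚ)) 3 ≤
      unramifiedOutside (torsionModule ((E.baseChange ℚ).quadTwist (d : ℚ)) 3)
        {PlaceQ.finite 3 Nat.prime_three} := by
  intro c hc
  obtain ⟨f, rfl⟩ := exists_contH1Mk_eq c
  simp only [unramifiedOutside, AddSubgroup.mem_iInf, AddMonoidHom.mem_ker]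
  rintro (_ | ⟨p, hp⟩) hv I hI
  · obtain ⟨ι, rfl⟩ := hI
    exact contH1Res_range_complex_eq_zero _ f ι
  · have := Fact.mk hp
    obtain ⟨ι, rfl⟩ := hI
    have hp3 : p ≠ 3 := by
      rintro rfl
      exact hv rfl
    have hloc := (AddSubgroup.mem_iInf.mp hc) (.finite p hp)
    exact contH1Res_padicInertia_eq_zero hp3 hE (hss p) (hord p) hd4 hcop f ι
      ((AddSubgroup.mem_iInf.mp hloc) ι)
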